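/- Let $\lambda$ be a strongly inaccessible cardinal and let $\bar\mu=\langle\mu_\alpha:\alpha<\lambda\rangle$ be a sequence of regular cardinals such that, for all $\alpha<\lambda$, $\aleph_0\le\mu_\alpha\le\lambda$ and $\big|\prod_{\xi<\alpha}f(\xi)\big|<\mu_\alpha$ for every $f:\alpha\to\mu_\alpha$. Assume moreover that $\mu_i\le\mu_j$ whenever $i<j<\lambda$. Let $\mathbb Q$ be a forcing notion, i.e. a preordered set of conditions, where larger conditions are stronger, which is atomless (every condition has two incompatible extensions). Then $\mathbb Q$ is reasonably A-bounding over $\bar\mu$ if and only if $\mathbb Q$ has the strong $\bar\mu$-Sacks property. Here $\Gamma$ is the canonical name for the generic filter in $\mathbb Q$, and the notions are as follows. **Strategic completeness.** For $r\in\mathbb Q$, two players, Complete and Incomplete, play a game of length $\lambda$: at stage $i<\lambda$ first Incomplete chooses $p_i\in\mathbb Q$ and then Complete chooses $q_i\in\mathbb Q$, so that $r\le p_j\le q_j\le p_i$ for $j<i<\lambda$. Complete wins if for every $i<\lambda$ there are legal moves for both players. $\mathbb Q$ is strategically $({<}\lambda)$-complete if for each $r\in\mathbb Q$ Complete has a winning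 strategy in this game. **Reasonably A-bounding.** For $p\in\mathbb Q$, two players, Generic and Antigeneric, play a game of length $\lambda$: at stage $\alpha<\lambda$ first Generic chooses a non-empty set $I_\alpha$ with $|I_\alpha|<\mu_\alpha$ and conditions $p^\alpha_t\in\mathbb Q$ ($t\in I_\alpha$), and then Antigeneric chooses conditions $q^\alpha_t\ge p^\alpha_t$ ($t\in I_\alpha$). Generic wins if there is $p^*\ge p$ such that $p^*\Vdash\{\alpha<\lambda:(\exists t\in I_\alpha)(q^\alpha_t\in\Gamma)\}=\lambda$. $\mathbb Q$ is reasonably A-bounding over $\bar\mu$ if it is strategically $({<}\lambda)$-complete and, for each $p\in\mathbb Q$, Generic has a winning strategy in this game. **Strong $\bar\mu$-Sacks property.** For sequences $\nu,\eta$ of ordinals, $\nu\trianglelefteq\eta$ means that $\nu$ is an initial segment of $\eta$, and $\nu\vartriangleleft\eta$ that it is a proper one. A complete $\lambda$-tree of height $\alpha<\lambda$ is a set $s\subseteq{}^{\le\alpha}\lambda$ that has a $\trianglelefteq$-smallest element $\mathrm{root}(s)$, contains every initial segment of each of its members that is longer than $\mathrm{root}(s)$, contains the union of every non-empty $\vartriangleleft$-increasing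 sequence of its members, and is such that for each $\eta\in s$ there is $\nu\in s$ of length $\alpha$ with $\eta\trianglelefteq\nu$. For $i_0<\lambda$ and $p\in\mathbb Q$, Generic and Antigeneric play a game with stages $i\in[i_0,\lambda)$. At stage $i$ first Generic chooses a set $s_i$ and conditions $p^i_\eta\in\mathbb Q$ for $\eta\in s_i\cap{}^{i+1}\lambda$ such that: $s_i$ is a complete $\lambda$-tree of height $i+1$ whose root has length $i_0$; $s_j=s_i\cap{}^{\le j+1}\lambda$ for $i_0\le j<i$; if $i_0\le j<i$, $\nu\in s_i\cap{}^{j+1}\lambda$ and $\nu\vartriangleleft\eta\in s_i\cap{}^{i+1}\lambda$, then $q^j_\nu\le p^i_\eta$ and $p\le p^i_\eta$; and $|s_i\cap{}^{i+1}\lambda|<\mu_i$. Then Antigeneric chooses conditions $q^i_\eta\ge p^i_\eta$ for $\eta\in s_i\cap{}^{i+1}\lambda$. Generic wins if she always has legal moves and there are $q\ge p$ and a $\mathbb Q$-name $\dot\rho$ such that $$q\Vdash\ \dot\rho\in{}^\lambda\lambda\ \text{ and }\ (\forall i\in[i_0,\lambda))\big(\dot\rho\restriction(i+1)\in s_i\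 \text{ and }\ q^i_{\dot\rho\restriction(i+1)}\in\Gamma\big).$$ $\mathbb Q$ has the strong $\bar\mu$-Sacks property if it is strategically $({<}\lambda)$-complete and, for all $i_0<\lambda$ and $p\in\mathbb Q$, Generic has a winning strategy in this game. -/

import Mathlib

universe u v a b

/-! ### Forcing notions (a stronger condition is the larger one) -/

/-- Two conditions are compatible if they have a common stronger condition. -/
def Compatible {Q : Type v} [Preorder Q] (p q : Q) : Prop :=
  ∃ r, p ≤ r ∧ q ≤ r

/-- Every condition has two incompatible extensions. -/
def Atomless (Q : Type v) [Preorder Q] : Prop :=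
  ∀ p : Q, ∃ q r : Q, p ≤ q ∧ p ≤ r ∧ ¬ Compatible q r

/-! ### The forcing relation

A statement of the forcing language (about ground model objects, names and the canonical
generic filter `Γ`) is represented by the predicate `p ↦ (p ⊩ φ)`; the definitions below are the
usual clauses of the forcing relation. -/

namespace Forcing

variable {Q : Type v} [Preorder Q]

/-- `p ⊩ A`, where `A` is a statement about ground model objects only. -/
def ground (A : Prop) : Q → Prop := fun _ => A

/-- `p ⊩ q ∈ Γ`: the conditions stronger than `q` are dense above `p`. -/
def inGeneric (q : Q) : Q → Prop := fun p => ∀ r, p ≤ r → ∃ s, r ≤ s ∧ q ≤ s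

/-- `p ⊩ φ ∧ ψ`. -/
def conj (φ ψ : Q → Prop) : Q → Prop := fun p => φ p ∧ ψ p

/-- `p ⊩ φ → ψ`. -/
def imp (φ ψ : Q → Prop) : Q → Prop := fun p => ∀ r, p ≤ r → φ r → ψ r

/-- `p ⊩ ∀ x ∈ X, φ x`, where `X` is a ground model set. -/
def all {X : Sort a} (φ : X → Q → Prop) : Q → Prop := fun p => ∀ x, φ x p

/-- `p ⊩ ∃ x ∈ X, φ x`, where `X` is a ground model set. -/
def ex {X : Sort a} (φ : X → Q → Prop) : Q → Prop :=
  fun p => ∀ r, p ≤ r → ∃ s, r ≤ s ∧ ∃ x, φ x s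

/-- A `Q`-name for a subset of the ground model set `X`: a set of pairs `(x̌, r)`.
Its interpretation is `{x | ∃ r ∈ Γ, (x, r) ∈ τ}`. -/
abbrev SubsetName (X : Type a) (Q : Type v) := Set (X × Q)

/-- `p ⊩ x ∈ τ`. -/
def mem {X : Type a} (x : X) (τ : SubsetName X Q) : Q → Prop :=
  ex fun r : {r : Q // (x, r) ∈ τ} => inGeneric r.1

/-- `p ⊩ τ is a function from X to Y`, where `τ` is a name for a subset of `X × Y`. -/
def isFunction {X : Type a} {Y : Type b} (τ : SubsetName (X × Y) Q) : Q → Prop :=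
  conj (all fun x : X => ex fun y : Y => mem (x, y) τ)
    (all fun x : X => all fun y : Y => all fun z : Y =>
      imp (conj (mem (x, y) τ) (mem (x, z) τ)) (ground (y = z)))

end Forcing

/-! ### Strategic completeness -/

section Completeness

variable {Q : Type v} [Preorder Q]

/-- A strategy of Complete: given the pairs `(p_j, q_j)` for `j < i` and the condition `p_i`
just chosen by Incomplete, it gives the condition `q_i`. -/
abbrev CompleteStrategy (Q : Type v) :=
  (i : Ordinal.{u}) → (Set.Iio i → Q × Q) → Q → Q

/-- `⟨(p_i, q_i) : i < k⟩` is a legal partial play above `r`. Only the terms `h i = (p_i, q_i)`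
with `i < k` matter. -/
def IsCompletenessPlay (r : Q) (h : Ordinal.{u} → Q × Q) (k : Ordinal.{u}) : Prop :=
  (∀ i < k, r ≤ (h i).1 ∧ (h i).1 ≤ (h i).2) ∧
    ∀ i < k, ∀ j < i, (h j).2 ≤ (h i).1

/-- `a` is a legal move of Incomplete at stage `k`. -/
def IsLegalIncomplete (r : Q) (h : Ordinal.{u} → Q × Q) (k : Ordinal.{u}) (a : Q) : Prop :=
  r ≤ a ∧ ∀ j < k, (h j).2 ≤ a

/-- `σ` is a winning strategy of Complete in the game of length `lam` above `r`: whenever she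
has followed `σ` up to a stage `k < lam`, Incomplete has a legal move, and to each of his legal
moves `σ` gives a legal answer. -/
def CompleteStrategy.IsWinning (lam : Cardinal.{u}) (r : Q) (σ : CompleteStrategy.{u} Q) : Prop :=
  ∀ (h : Ordinal.{u} → Q × Q) (k : Ordinal.{u}), k < lam.ord →
    IsCompletenessPlay r h k →
    (∀ i < k, (h i).2 = σ i (Set.domRestrict (Set.Iio i) h) (h i).1) →
    (∃ a, IsLegalIncomplete r h k a) ∧
      ∀ a, IsLegalIncomplete r h k a → a ≤ σ k (Set.domRestrict (Set.Iio k) h) a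

/-- `Q` is strategically `(<lam)`-complete. -/
def StrategicallyComplete (lam : Cardinal.{u}) (Q : Type v) [Preorder Q] : Prop :=
  ∀ r : Q, ∃ σ : CompleteStrategy.{u} Q, σ.IsWinning lam r

end Completeness

/-! ### Games of Generic and Antigeneric

At each stage `i` with `start ≤ i < finish`, first Generic makes a move and then Antigeneric
replies to it. -/

structure GenericGame where
  /-- the first stage -/
  start : Ordinal.{u}
  /-- the first ordinal that is not a stage -/
  finish : Ordinal.{u}
  /-- Generic's moves at a stage -/
  Move : Ordinal.{u} → Type a
  /-- Antigeneric's replies to a move -/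
  Reply : (i : Ordinal.{u}) → Move i → Type b
  /-- which moves are legal, given what has been played at the earlier stages -/
  LegalMove : (i : Ordinal.{u}) →
    ((j : Set.Ico start i) → (m : Move j) × Reply j m) → Move i → Prop
  /-- which replies are legal -/
  LegalReply : (i : Ordinal.{u}) → (m : Move i) → Reply i m → Prop
  /-- Generic's winning criterion, for plays that have lasted through all stages -/
  Won : ((j : Set.Ico start finish) → (m : Move j) × Reply j m) → Prop

namespace GenericGame

variable (G : GenericGame.{u, a, b})

/-- What is played at stage `i`: a move of Generic and a reply of Antigeneric. -/
abbrev Round (i : Ordinal.{u}) := (m : G.Move i) × G.Reply i m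

/-- What has been played before stage `i`. -/
abbrev History (i : Ordinal.{u}) := (j : Set.Ico G.start i) → G.Round j

/-- The part of a (partial) play of length `k` before an earlier stage `i`. -/
def History.before {G : GenericGame.{u, a, b}} {k : Ordinal.{u}} (h : G.History k)
    (i : Set.Ico G.start k) : G.History i :=
  fun j => h ⟨j, j.2.1, j.2.2.trans i.2.2⟩

/-- A strategy of Generic. -/
abbrev Strategy := (i : Ordinal.{u}) → G.History i → G.Move i

/-- Generic's moves are given by `σ` and Antigeneric's replies are legal. -/
def Follows (σ : G.Strategy) {k : Ordinal.{u}} (h : G.History k) : Prop :=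
  ∀ i : Set.Ico G.start k,
    (h i).1 = σ i (h.before i) ∧ G.LegalReply i (h i).1 (h i).2

/-- Whenever Generic has followed `σ` so far, `σ` gives her a legal move, and every play in which
she follows `σ` to the end is won by her. -/
def IsWinning (σ : G.Strategy) : Prop :=
  (∀ k, G.start ≤ k → k < G.finish → ∀ h : G.History k, G.Follows σ h → G.LegalMove k h (σ k h)) ∧
    ∀ h : G.History G.finish, G.Follows σ h → G.Won h

/-- Generic has a winning strategy. -/
def GenericHasWinningStrategy : Prop := ∃ σ : G.Strategy, G.IsWinning σ

end GenericGame

/-! ### The reasonable A-bounding property -/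

/-- A set `I` with a system of conditions indexed by it. -/
structure SystemMove (Q : Type v) where
  I : Type u
  cond : I → Q

/-- The game `rcA` over `μ` for the condition `p`. Generic wins if some `p' ≥ p` forces
`{α < lam : ∃ t ∈ I_α, q^α_t ∈ Γ} = lam`. -/
noncomputable def rcAGame (lam : Cardinal.{u}) (μ : Ordinal.{u} → Cardinal.{u}) {Q : Type v} [Preorder Q]
    (p : Q) : GenericGame.{u, max (u + 1) v, max u v} where
  start := 0
  finish := lam.ord
  Move _ := SystemMove.{u} Q
  Reply _ m := m.I → Q
  LegalMove α _ m := Nonempty m.I ∧ Cardinal.mk m.I < μ α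
  LegalReply _ m q := ∀ t, m.cond t ≤ q t
  Won h := ∃ p', p ≤ p' ∧
    (Forcing.all fun α : Set.Ico 0 lam.ord =>
      Forcing.ex fun t : (h α).1.I => Forcing.inGeneric ((h α).2 t)) p'

/-- `Q` is reasonably A-bounding over `μ`. -/
def ReasonablyABounding (lam : Cardinal.{u}) (μ : Ordinal.{u} → Cardinal.{u})
    (Q : Type v) [Preorder Q] : Prop :=
  StrategicallyComplete lam Q ∧ ∀ p : Q, (rcAGame lam μ p).GenericHasWinningStrategy

/-! ### The strong Sacks property -/

/-- Transfinite sequences of ordinals below `lam`. -/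
structure LSeq (lam : Cardinal.{u}) where
  len : Ordinal.{u}
  val : Set.Iio len → Set.Iio lam.ord

namespace LSeq

variable {lam : Cardinal.{u}}

/-- `ν` is a (not necessarily proper) initial segment of `η`. -/
def IsInitial (ν η : LSeq lam) : Prop :=
  ∃ h : ν.len ≤ η.len, ∀ ξ : Set.Iio ν.len, ν.val ξ = η.val ⟨ξ, ξ.2.trans_le h⟩

/-- `ν` is a proper initial segment of `η`. -/
def IsProperInitial (ν η : LSeq lam) : Prop := ν.IsInitial η ∧ ν ≠ η

/-- `η` is the union of the sequences in `C`. -/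
def IsUnion (C : Set (LSeq lam)) (η : LSeq lam) : Prop :=
  (∀ ν ∈ C, ν.IsInitial η) ∧ ∀ ξ < η.len, ∃ ν ∈ C, ξ < ν.len

/-- `r` is the smallest element of `s`. -/
def IsRoot (s : Set (LSeq lam)) (r : LSeq lam) : Prop :=
  r ∈ s ∧ ∀ η ∈ s, r.IsInitial η

end LSeq

/-- `s` is a complete `lam`-tree of height `α`. -/
structure IsCompleteTree {lam : Cardinal.{u}} (s : Set (LSeq lam)) (α : Ordinal.{u}) : Prop where
  exists_root : ∃ r, LSeq.IsRoot s r
  initial_mem : ∀ r, LSeq.IsRoot s r →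
    ∀ η ∈ s, ∀ ν : LSeq lam, ν.IsInitial η → r.len < ν.len → ν ∈ s
  union_mem : ∀ C ⊆ s, C.Nonempty → IsChain LSeq.IsInitial C → ∀ η, LSeq.IsUnion C η → η ∈ s
  len_le : ∀ η ∈ s, η.len ≤ α
  exists_extension : ∀ η ∈ s, ∃ ν ∈ s, η.IsInitial ν ∧ ν.len = α

/-- The members of `s` of length `i + 1`. -/
abbrev TopLevel {lam : Cardinal.{u}} (s : Set (LSeq lam)) (i : Ordinal.{u}) :=
  {η : LSeq lam // η ∈ s ∧ η.len = i + 1}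

/-- A set of sequences with a system of conditions indexed by its members of length `i + 1`. -/
structure SacksMove (lam : Cardinal.{u}) (Q : Type v) (i : Ordinal.{u}) where
  tree : Set (LSeq lam)
  cond : TopLevel tree i → Q

/-- The Sacks game over `μ` for the ordinal `i₀` and the condition `p`. Generic wins if there are
`q ≥ p` and a name `ρ` such that `q` forces `ρ` to be a function from `lam` to `lam` such that,
for each `i ∈ [i₀, lam)`, some `η ∈ s_i` of length `i + 1` is the restriction of `ρ` to `i + 1`
and `q^i_η ∈ Γ`. -/
noncomputable def sacksGame (lam : Cardinal.{u}) (μ : Ordinal.{u} → Cardinal.{u}) {Q : Type v} [Preorder Q]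
    (i₀ : Ordinal.{u}) (p : Q) : GenericGame.{u, max (u + 1) v, max (u + 1) v} where
  start := i₀
  finish := lam.ord
  Move i := SacksMove lam Q i
  Reply i m := TopLevel m.tree i → Q
  LegalMove i h m :=
    IsCompleteTree m.tree (i + 1) ∧
    (∃ r, LSeq.IsRoot m.tree r ∧ r.len = i₀) ∧
    (∀ j : Set.Ico i₀ i, (h j).1.tree = {η ∈ m.tree | η.len ≤ (j : Ordinal.{u}) + 1}) ∧
    (∀ (j : Set.Ico i₀ i) (ν : TopLevel (h j).1.tree j) (η : TopLevel m.tree i),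
      ν.1.IsProperInitial η.1 → (h j).2 ν ≤ m.cond η ∧ p ≤ m.cond η) ∧
    Cardinal.mk (TopLevel m.tree i) < Cardinal.lift.{u + 1} (μ i)
  LegalReply _ m q := ∀ η, m.cond η ≤ q η
  Won h := ∃ q, p ≤ q ∧
    ∃ ρ : Forcing.SubsetName (Set.Iio lam.ord × Set.Iio lam.ord) Q,
      Forcing.conj (Forcing.isFunction ρ)
        (Forcing.all fun i : Set.Ico i₀ lam.ord =>
          Forcing.ex fun η : TopLevel (h i).1.tree i =>
            Forcing.conj
              (Forcing.all fun j : Set.Iio lam.ord =>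
                Forcing.all fun hj : (j : Ordinal.{u}) < η.1.len =>
                  Forcing.mem (j, η.1.val ⟨j, hj⟩) ρ)
              (Forcing.inGeneric ((h i).2 η))) q

/-- `Q` has the strong `μ`-Sacks property. -/
def StrongSacksProperty (lam : Cardinal.{u}) (μ : Ordinal.{u} → Cardinal.{u})
    (Q : Type v) [Preorder Q] : Prop :=
  StrategicallyComplete lam Q ∧
    ∀ i₀ < lam.ord, ∀ p : Q, (sacksGame lam μ i₀ p).GenericHasWinningStrategy

universe w

/-! ### Incompatibility -/

section Incompatible

variable {Q : Type v} [Preorder Q]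

theorem not_compatible_mono {p q p' q' : Q} (h : ¬ Compatible p q) (hp : p ≤ p') (hq : q ≤ q') :
    ¬ Compatible p' q' :=
  fun ⟨r, h₁, h₂⟩ => h ⟨r, hp.trans h₁, hq.trans h₂⟩

theorem not_compatible_symm {p q : Q} (h : ¬ Compatible p q) : ¬ Compatible q p :=
  fun ⟨r, h₁, h₂⟩ => h ⟨r, h₂, h₁⟩

/-- In an atomless forcing any two conditions have incompatible extensions. -/
theorem Atomless.exists_not_compatible (hQ : Atomless Q) (p q : Q) :
    ∃ p' q', p ≤ p' ∧ q ≤ q' ∧ ¬ Compatible p' q' := by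
  obtain ⟨r₀, r₁, h₀, h₁, h⟩ := hQ p
  by_cases hc : Compatible r₀ q
  · obtain ⟨s, hs₀, hs₁⟩ := hc
    exact ⟨r₁, s, h₁, hs₁, not_compatible_mono (not_compatible_symm h) le_rfl hs₀⟩
  · exact ⟨r₀, q, h₀, le_rfl, hc⟩

end Incompatible

/-! ### Consequences of strategic completeness -/

section Completeness

variable {Q : Type v} [Preorder Q]

/-- Powers of a strategically complete forcing are strategically complete. -/
theorem StrategicallyComplete.pi {lam : Cardinal.{u}} (hQ : StrategicallyComplete lam Q)
    (J : Type w) : StrategicallyComplete lam (J → Q) := by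
  intro r
  choose c hc using hQ
  refine ⟨fun i h a t => c (r t) i (fun j => ((h j).1 t, (h j).2 t)) (a t), ?_⟩
  intro h k hk hplay hfol
  have key : ∀ t, _ := fun t => hc (r t) (fun i => ((h i).1 t, (h i).2 t)) k hk
    ⟨fun i hi => ⟨(hplay.1 i hi).1 t, (hplay.1 i hi).2 t⟩, fun i hi j hj => hplay.2 i hi j hj t⟩
    (fun i hi => congrFun (hfol i hi) t)
  refine ⟨?_, fun a ha t => (key t).2 (a t) ⟨ha.1 t, fun j hj => ha.2 j hj t⟩⟩
  choose a ha using fun t => (key t).1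
  exact ⟨a, fun t => (ha t).1, fun j hj t => (ha t).2 j hj⟩

/-- In a strategically `(<lam)`-complete forcing, fewer than `lam` open dense sets have dense
intersection; the sets are indexed here by an ordinal. -/
theorem StrategicallyComplete.exists_mem_of_ordinal {lam : Cardinal.{u}}
    (hQ : StrategicallyComplete lam Q) {o : Ordinal.{u}} (ho : o < lam.ord)
    (D : Ordinal.{u} → Set Q) (hup : ∀ k < o, ∀ p q, p ≤ q → p ∈ D k → q ∈ D k)
    (hD : ∀ k < o, ∀ p, ∃ q, p ≤ q ∧ q ∈ D k) (p : Q) :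
    ∃ q, p ≤ q ∧ ∀ k < o, q ∈ D k := by
  obtain ⟨c, hc⟩ := hQ p
  have : Nonempty Q := ⟨p⟩
  let A : (i : Ordinal.{u}) → (Set.Iio i → Q × Q) → Q := fun i past =>
    Classical.epsilon fun x => p ≤ x ∧ (∀ j : Set.Iio i, (past j).2 ≤ x) ∧ x ∈ D i
  let h : Ordinal.{u} → Q × Q := fun i => WellFoundedLT.fix (motive := fun _ => Q × Q)
    (fun i ih => (A i (fun j => ih j.1 j.2), c i (fun j => ih j.1 j.2) (A i (fun j => ih j.1 j.2)))) i
  have hh : ∀ i, h i = (A i (Set.domRestrict (Set.Iio i) h),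
      c i (Set.domRestrict (Set.Iio i) h) (A i (Set.domRestrict (Set.Iio i) h))) := by
    intro i
    exact WellFoundedLT.fix_eq (motive := fun _ => Q × Q) _ i
  have hfol : ∀ i, (h i).2 = c i (Set.domRestrict (Set.Iio i) h) (h i).1 := fun i => by
    rw [hh i]
  have main : ∀ k, k ≤ o → ∀ i < k, (p ≤ (h i).1 ∧ (h i).1 ≤ (h i).2) ∧
      (∀ j < i, (h j).2 ≤ (h i).1) ∧ (h i).1 ∈ D i := by
    intro k
    induction k using WellFoundedLT.induction with
    | ind k ih =>
      intro hk i hi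
      have hio : i < o := hi.trans_le hk
      have prev := ih i hi hio.le
      obtain ⟨⟨x, hx⟩, hans⟩ := hc h i (hio.trans ho)
        ⟨fun j hj => (prev j hj).1, fun j hj => (prev j hj).2.1⟩ (fun j _ => hfol j)
      obtain ⟨y, hxy, hy⟩ := hD i hio x
      have hA : p ≤ (h i).1 ∧ (∀ j : Set.Iio i, (h j).2 ≤ (h i).1) ∧ (h i).1 ∈ D i := by
        have := Classical.epsilon_spec (p := fun x => p ≤ x ∧
          (∀ j : Set.Iio i, (Set.domRestrict (Set.Iio i) h j).2 ≤ x) ∧ x ∈ D i)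
          ⟨y, hx.1.trans hxy, fun j => (hx.2 j.1 j.2).trans hxy, hy⟩
        have h1 : (h i).1 = A i (Set.domRestrict (Set.Iio i) h) := by rw [hh i]
        rw [h1]
        exact this
      refine ⟨⟨hA.1, ?_⟩, fun j hj => hA.2.1 ⟨j, hj⟩, hA.2.2⟩
      rw [hfol i]
      exact hans _ ⟨hA.1, fun j hj => hA.2.1 ⟨j, hj⟩⟩
  have prev := main o le_rfl
  obtain ⟨⟨x, hx⟩, -⟩ := hc h o ho
    ⟨fun j hj => (prev j hj).1, fun j hj => (prev j hj).2.1⟩ (fun j _ => hfol j)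
  exact ⟨x, hx.1, fun k hk => hup k hk _ _ ((prev k hk).1.2.trans (hx.2 k hk)) (prev k hk).2.2⟩

/-- In a strategically `(<lam)`-complete forcing, fewer than `lam` open dense sets have dense
intersection. -/
theorem StrategicallyComplete.exists_mem {lam : Cardinal.{u}}
    (hQ : StrategicallyComplete lam Q) {K : Type u} (hK : Cardinal.mk K < lam)
    (D : K → Set Q) (hup : ∀ k p q, p ≤ q → p ∈ D k → q ∈ D k)
    (hD : ∀ k p, ∃ q, p ≤ q ∧ q ∈ D k) (p : Q) :
    ∃ q, p ≤ q ∧ ∀ k, q ∈ D k := by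
  obtain ⟨e⟩ : Nonempty (Set.Iio (Cardinal.mk K).ord ≃ K) := by
    have : Cardinal.lift.{u} (Cardinal.mk (Set.Iio (Cardinal.mk K).ord)) =
        Cardinal.lift.{u+1} (Cardinal.mk K) := by simp
    exact Cardinal.lift_mk_eq'.1 this
  classical
  obtain ⟨q, hpq, hq⟩ := hQ.exists_mem_of_ordinal (Cardinal.ord_lt_ord.2 hK)
    (fun k => {x | ∀ hk : k < (Cardinal.mk K).ord, x ∈ D (e ⟨k, hk⟩)})
    (fun k _ x y hxy hx hk => hup _ x y hxy (hx hk))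
    (fun k hk x => by
      obtain ⟨y, hxy, hy⟩ := hD (e ⟨k, hk⟩) x
      exact ⟨y, hxy, fun _ => hy⟩) p
  refine ⟨q, hpq, fun k => ?_⟩
  have := hq (e.symm k).1 (e.symm k).2 (e.symm k).2
  simpa using this

/-- A family of fewer than `lam` conditions can be extended to a family of pairwise incompatible
conditions lying in fewer than `lam` given open dense sets. -/
theorem StrategicallyComplete.exists_antichain {lam : Cardinal.{u}} (hlam : Cardinal.aleph0 ≤ lam)
    (hQ : StrategicallyComplete lam Q) (hat : Atomless Q) {J K : Type u}
    (hJ : Cardinal.mk J < lam) (hK : Cardinal.mk K < lam)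
    (D : K → Set Q) (hup : ∀ k p q, p ≤ q → p ∈ D k → q ∈ D k)
    (hD : ∀ k p, ∃ q, p ≤ q ∧ q ∈ D k) (f₀ : J → Q) :
    ∃ f : J → Q, f₀ ≤ f ∧ (∀ x y, x ≠ y → ¬ Compatible (f x) (f y)) ∧ ∀ x k, f x ∈ D k := by
  classical
  obtain ⟨f, hf, h⟩ := (hQ.pi J).exists_mem (K := (J × J) ⊕ (J × K))
    (by
      rw [Cardinal.mk_sum, Cardinal.lift_id, Cardinal.lift_id, Cardinal.mk_prod, Cardinal.mk_prod,
        Cardinal.lift_id, Cardinal.lift_id]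
      exact Cardinal.add_lt_of_lt hlam (Cardinal.mul_lt_of_lt hlam hJ hJ)
        (Cardinal.mul_lt_of_lt hlam hJ hK))
    (Sum.elim (fun z => {f | z.1 ≠ z.2 → ¬ Compatible (f z.1) (f z.2)})
      (fun z => {f | f z.1 ∈ D z.2}))
    (by
      rintro (z | z) f g hfg h
      · exact fun hz => not_compatible_mono (h hz) (hfg _) (hfg _)
      · exact hup _ _ _ (hfg _) h)
    (by
      rintro (⟨x, y⟩ | ⟨x, k⟩) f
      · by_cases hxy : x = y
        · exact ⟨f, le_rfl, fun h => absurd hxy h⟩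
        · obtain ⟨p, q, hp, hq, hpq⟩ := hat.exists_not_compatible (f x) (f y)
          refine ⟨Function.update (Function.update f x p) y q, ?_, fun _ => ?_⟩
          · intro t
            by_cases hty : t = y
            · subst hty; simpa using hq
            · by_cases htx : t = x
              · subst htx; simpa [hty] using hp
              · simp [hty, htx]
          · simpa [hxy] using hpq
      · obtain ⟨q, hq, hqD⟩ := hD k (f x)
        refine ⟨Function.update f x q, ?_, by simpa using hqD⟩
        intro t
        by_cases htx : t = x
        · subst htx; simpa using hq
        · simp [htx])
    f₀
  exact ⟨f, hf, fun x y => h (Sum.inl (x, y)), fun x k => h (Sum.inr (x, k))⟩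

end Completeness

/-! ### Truncating and extending sequences -/

namespace LSeq

variable {lam : Cardinal.{u}}

theorem ext_val {ν η : LSeq lam} (hl : ν.len = η.len)
    (hv : ∀ ξ (h : ξ < ν.len) (h' : ξ < η.len), ν.val ⟨ξ, h⟩ = η.val ⟨ξ, h'⟩) : ν = η := by
  obtain ⟨l, v⟩ := ν
  obtain ⟨l', v'⟩ := η
  obtain rfl : l = l' := hl
  congr
  funext ξ
  exact hv ξ.1 ξ.2 ξ.2

open Classical in
/-- The sequence of length `k` that agrees with `η` where `η` is defined and has the value `z`
elsewhere. -/
noncomputable def take (z : Set.Iio lam.ord) (η : LSeq lam) (k : Ordinal.{u}) : LSeq lam :=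
  ⟨k, fun ξ => if h : ξ.1 < η.len then η.val ⟨ξ, h⟩ else z⟩

variable (z : Set.Iio lam.ord)

@[simp] theorem take_len (η : LSeq lam) (k : Ordinal.{u}) : (η.take z k).len = k := rfl

theorem take_val_of_lt (η : LSeq lam) {k ξ : Ordinal.{u}} (h : ξ < k) (h' : ξ < η.len) :
    (η.take z k).val ⟨ξ, h⟩ = η.val ⟨ξ, h'⟩ := dif_pos h'

theorem take_val_of_le (η : LSeq lam) {k ξ : Ordinal.{u}} (h : ξ < k) (h' : η.len ≤ ξ) :
    (η.take z k).val ⟨ξ, h⟩ = z := dif_neg h'.not_gt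

@[simp] theorem take_self (η : LSeq lam) : η.take z η.len = η :=
  ext_val rfl fun _ _ h' => take_val_of_lt z η h' h'

theorem take_take (η : LSeq lam) {j k : Ordinal.{u}} (h : j ≤ k ∨ η.len ≤ k) :
    (η.take z k).take z j = η.take z j := by
  refine ext_val rfl fun ξ h₁ h₂ => ?_
  change ξ < j at h₁ h₂
  by_cases hk : ξ < k
  · rw [take_val_of_lt z (η.take z k) h₁ (show ξ < (η.take z k).len from hk)]
    rfl
  · have hη : η.len ≤ ξ := by
      rcases h with h | h
      · exact absurd (h₁.trans_le h) hk
      · exact h.trans (not_lt.1 hk)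
    rw [take_val_of_le z (η.take z k) h₁ (not_lt.1 hk), take_val_of_le z η h₁ hη]

theorem isInitial_iff {ν η : LSeq lam} :
    ν.IsInitial η ↔ ν.len ≤ η.len ∧ η.take z ν.len = ν := by
  constructor
  · rintro ⟨h, hv⟩
    refine ⟨h, ext_val rfl fun ξ h₁ h₂ => ?_⟩
    exact (take_val_of_lt z η h₂ (h₂.trans_le h)).trans (hv ⟨ξ, h₂⟩).symm
  · rintro ⟨h, hv⟩
    refine ⟨h, fun ξ => ?_⟩
    have h1 := take_val_of_lt z η ξ.2 (ξ.2.trans_le h)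
    rw [← h1]
    congr 1
    simp [hv]

theorem isInitial_take (η : LSeq lam) {k : Ordinal.{u}} (h : k ≤ η.len) :
    (η.take z k).IsInitial η := (isInitial_iff z).2 ⟨h, rfl⟩

theorem isInitial_take_of_le (η : LSeq lam) {k : Ordinal.{u}} (h : η.len ≤ k) :
    η.IsInitial (η.take z k) :=
  (isInitial_iff z).2 ⟨h, by rw [take_take z η (Or.inl h), take_self]⟩

theorem IsInitial.trans {ν η θ : LSeq lam} (h₁ : ν.IsInitial η) (h₂ : η.IsInitial θ) :
    ν.IsInitial θ :=
  ⟨h₁.1.trans h₂.1, fun ξ => (h₁.2 ξ).trans (h₂.2 ⟨ξ, ξ.2.trans_le h₁.1⟩)⟩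

theorem IsInitial.take_eq {ν η : LSeq lam} (h : ν.IsInitial η) {k : Ordinal.{u}}
    (hk : k ≤ ν.len) : η.take z k = ν.take z k := by
  rw [← ((isInitial_iff z).1 h).2, take_take z η (Or.inl hk)]

theorem val_eq_of_take_eq {ν η : LSeq lam} {k ξ : Ordinal.{u}} (h : ν.take z k = η.take z k)
    (hk : ξ < k) (hν : ξ < ν.len) (hη : ξ < η.len) : ν.val ⟨ξ, hν⟩ = η.val ⟨ξ, hη⟩ := by
  rw [← take_val_of_lt z ν hk hν, ← take_val_of_lt z η hk hη]
  simp only [take, LSeq.mk.injEq, heq_eq_eq, true_and] at h ⊢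
  exact congrFun h ⟨ξ, hk⟩

/-- The extension of `η` by the value `ξ`. -/
noncomputable def child (η : LSeq lam) (ξ : Set.Iio lam.ord) : LSeq lam := η.take ξ (η.len + 1)

@[simp] theorem child_len (η : LSeq lam) (ξ : Set.Iio lam.ord) : (η.child ξ).len = η.len + 1 := rfl

theorem child_take (η : LSeq lam) (ξ : Set.Iio lam.ord) {k : Ordinal.{u}} (h : k ≤ η.len) :
    (η.child ξ).take z k = η.take z k :=
  (isInitial_take_of_le ξ η (by simp)).take_eq z h

theorem child_injective {ν η : LSeq lam} {ξ ζ : Set.Iio lam.ord} (h : ν.child ξ = η.child ζ) :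
    ν = η ∧ ξ = ζ := by
  have hl : ν.len = η.len := by
    have := congrArg len h
    simpa using this
  have h1 : ν = η := by
    have h2 := child_take ξ ν ξ le_rfl
    have h3 := child_take ξ η ζ le_rfl
    rw [take_self] at h2 h3
    rw [← h2, ← h3, h, hl]
  subst h1
  refine ⟨rfl, ?_⟩
  have hlt : ν.len < ν.len + 1 := by simp
  have h2 : (ν.child ξ).val ⟨ν.len, hlt⟩ = ξ := take_val_of_le ξ ν hlt le_rfl
  have h3 : (ν.child ζ).val ⟨ν.len, hlt⟩ = ζ := take_val_of_le ζ ν hlt le_rfl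
  rw [← h2, ← h3]
  congr 1

end LSeq

/-! ### The strong Sacks property implies the reasonable A-bounding property -/

theorem Cardinal.small_of_lt_lift {α : Type (u + 1)} {κ : Cardinal.{u}}
    (h : Cardinal.mk α < Cardinal.lift.{u + 1} κ) : Small.{u} α := by
  obtain ⟨c, -, hc⟩ := Cardinal.lt_lift_iff.1 h
  rw [Cardinal.small_iff_lift_mk_lt_univ, ← hc]
  simpa using Cardinal.lift_lt_univ' c

theorem Cardinal.mk_shrink_lt {α : Type (u + 1)} [Small.{u} α] {κ : Cardinal.{u}}
    (h : Cardinal.mk α < Cardinal.lift.{u + 1} κ) : Cardinal.mk (Shrink.{u} α) < κ := by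
  rw [← Cardinal.lift_lt.{u, u + 1}]
  rwa [Cardinal.lift_mk_shrink''.{u + 1, u}]

section SacksToSystem

variable {lam : Cardinal.{u}} {Q : Type v}

open Classical in
/-- The system of conditions of a move in the Sacks game, with a small index set. -/
noncomputable def SacksMove.toSystem {i : Ordinal.{u}} (m : SacksMove lam Q i) : SystemMove.{u} Q :=
  if _ : Small.{u} (TopLevel m.tree i) then
    ⟨Shrink.{u} (TopLevel m.tree i), fun t => m.cond ((equivShrink _).symm t)⟩
  else ⟨PEmpty, PEmpty.elim⟩

theorem SacksMove.toSystem_of_small {i : Ordinal.{u}} (m : SacksMove lam Q i)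
    [h : Small.{u} (TopLevel m.tree i)] : m.toSystem =
      ⟨Shrink.{u} (TopLevel m.tree i), fun t => m.cond ((equivShrink _).symm t)⟩ := dif_pos h

open Classical in
/-- The reply to a move in the Sacks game obtained from a reply to the corresponding system. -/
noncomputable def SacksMove.replyOfSystem {i : Ordinal.{u}} (m : SacksMove lam Q i)
    (R : (s : SystemMove.{u} Q) × (s.I → Q)) : TopLevel m.tree i → Q :=
  if h : ∃ g : TopLevel m.tree i → R.1.I, ∀ η, R.1.cond (g η) = m.cond η then
    fun η => R.2 (h.choose η)
  else m.cond

theorem SacksMove.replyOfSystem_spec {i : Ordinal.{u}} (m : SacksMove lam Q i)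
    [Small.{u} (TopLevel m.tree i)] (R : (s : SystemMove.{u} Q) × (s.I → Q))
    (hR : R.1 = m.toSystem) (η : TopLevel m.tree i) :
    ∃ t, m.replyOfSystem R η = R.2 t ∧ R.1.cond t = m.cond η := by
  have h : ∃ g : TopLevel m.tree i → R.1.I, ∀ η, R.1.cond (g η) = m.cond η := by
    obtain ⟨s, r⟩ := R
    obtain rfl : s = _ := hR.trans m.toSystem_of_small
    exact ⟨fun η => equivShrink _ η, fun η => by simp⟩
  exact ⟨h.choose η, by rw [SacksMove.replyOfSystem, dif_pos h], h.choose_spec η⟩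

theorem SacksMove.toSystem_legal {i : Ordinal.{u}} {m : SacksMove lam Q i} {κ : Cardinal.{u}}
    (htree : IsCompleteTree m.tree (i + 1))
    (h : Cardinal.mk (TopLevel m.tree i) < Cardinal.lift.{u + 1} κ) :
    Nonempty m.toSystem.I ∧ Cardinal.mk m.toSystem.I < κ := by
  have := Cardinal.small_of_lt_lift h
  rw [m.toSystem_of_small]
  constructor
  · obtain ⟨r, hr, -⟩ := htree.exists_root
    obtain ⟨ν, hν, -, hl⟩ := htree.exists_extension r hr
    exact ⟨equivShrink _ ⟨ν, hν, hl⟩⟩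
  · exact Cardinal.mk_shrink_lt h

variable [Preorder Q]

/-- A winning strategy for Generic in the Sacks game that starts at `0` gives a winning strategy
in the game of systems. -/
theorem GenericGame.GenericHasWinningStrategy.rcAGame_of_sacksGame
    {μ : Ordinal.{u} → Cardinal.{u}} {p : Q}
    (h : (sacksGame lam μ 0 p).GenericHasWinningStrategy) :
    (rcAGame lam μ p).GenericHasWinningStrategy := by
  obtain ⟨τ, hlegal, hwon⟩ := h
  let S : (i : Ordinal.{u}) → (rcAGame lam μ p).History i → SacksMove lam Q i :=
    fun i => WellFoundedLT.fix
      (motive := fun i => (rcAGame lam μ p).History i → SacksMove lam Q i)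
      (fun i ih h => τ i fun j =>
        ⟨ih j.1 j.2.2 (h.before j), (ih j.1 j.2.2 (h.before j)).replyOfSystem (h j)⟩) i
  let g : {k : Ordinal.{u}} → (rcAGame lam μ p).History k → (sacksGame lam μ 0 p).History k :=
    fun h j => ⟨S j.1 (h.before j), (S j.1 (h.before j)).replyOfSystem (h j)⟩
  have hS : ∀ i (h : (rcAGame lam μ p).History i), S i h = τ i (g h) := fun i h =>
    congrFun (WellFoundedLT.fix_eq
      (motive := fun i => (rcAGame lam μ p).History i → SacksMove lam Q i) _ i) h
  let σ : (rcAGame lam μ p).Strategy := fun i h => (S i h).toSystem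
  have hfol : ∀ k, k ≤ lam.ord → ∀ h : (rcAGame lam μ p).History k,
      (rcAGame lam μ p).Follows σ h → (sacksGame lam μ 0 p).Follows τ (g h) := by
    intro k
    induction k using WellFoundedLT.induction with
    | ind k ih =>
      intro hk h hh i
      have hSi : S i.1 (h.before i) = τ i.1 (g (h.before i)) := hS _ _
      refine ⟨hSi, ?_⟩
      have h1 := hlegal i.1 i.2.1 (i.2.2.trans_le hk) (g (h.before i))
        (ih i.1 i.2.2 (i.2.2.le.trans hk) _ fun j => hh ⟨j.1, j.2.1, j.2.2.trans i.2.2⟩)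
      rw [← hSi] at h1
      have := Cardinal.small_of_lt_lift h1.2.2.2.2
      intro η
      obtain ⟨t, ht, hc⟩ := (S i.1 (h.before i)).replyOfSystem_spec (h i) (hh i).1 η
      change (S i.1 (h.before i)).cond η ≤ (S i.1 (h.before i)).replyOfSystem (h i) η
      rw [ht, ← hc]
      exact (hh i).2 t
  refine ⟨σ, fun k h0 hk h hh => ?_, fun h hh => ?_⟩
  · have h1 := hlegal k h0 hk (g h) (hfol k hk.le h hh)
    rw [← hS] at h1
    exact SacksMove.toSystem_legal h1.1 h1.2.2.2.2
  · obtain ⟨q, hpq, ρ, -, hq⟩ := hwon (g h) (hfol _ le_rfl h hh)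
    refine ⟨q, hpq, fun α r hr => ?_⟩
    obtain ⟨s, hrs, η, -, hη⟩ := hq α r hr
    have h1 := hlegal α.1 α.2.1 α.2.2 (g (h.before α))
      (hfol α.1 α.2.2.le _ fun j => hh ⟨j.1, j.2.1, j.2.2.trans α.2.2⟩)
    rw [← hS] at h1
    have := Cardinal.small_of_lt_lift h1.2.2.2.2
    obtain ⟨t, ht, -⟩ := (S α.1 (h.before α)).replyOfSystem_spec (h α) (hh α).1 η
    refine ⟨s, hrs, t, ?_⟩
    exact (congrArg (fun x => Forcing.inGeneric x s) ht).mp hη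

end SacksToSystem

/-! ### Simulating the game of systems in the Sacks game -/

/-- What Generic remembers at a stage of the Sacks game: the new top level of the tree, the moves
of Incomplete and Complete in the auxiliary games played along the branches, her move in the
simulated game of systems, and for each index of that move either a node whose condition she takes
for the simulated reply, or that reply itself. -/
structure SacksMemory (lam : Cardinal.{u}) (Q : Type v) where
  top : Set (LSeq lam)
  incomplete : LSeq lam → Q
  complete : LSeq lam → Q
  sys : SystemMove.{u} Q
  target : sys.I → LSeq lam ⊕ Q

/-- What Generic remembers at a stage, with the reply of Antigeneric. -/
abbrev SacksRecord (lam : Cardinal.{u}) (Q : Type v) := SacksMemory lam Q × (LSeq lam → Q)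

/-- The round of the simulated game of systems. -/
def SacksRecord.round {lam : Cardinal.{u}} {Q : Type v} (x : SacksRecord lam Q) :
    (s : SystemMove.{u} Q) × (s.I → Q) :=
  ⟨x.1.sys, fun t => Sum.elim x.2 id (x.1.target t)⟩

/-- The parameters of the simulation: a filler for sequences, the first stage and the condition of
the Sacks game, a strategy in the game of systems and a strategy of Complete. -/
structure SacksSimulation (lam : Cardinal.{u}) (μ : Ordinal.{u} → Cardinal.{u}) (Q : Type v)
    [Preorder Q] where
  z : Set.Iio lam.ord
  start : Ordinal.{u}
  base : Q
  strategy : (rcAGame lam μ base).Strategy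
  completion : CompleteStrategy.{u} Q

namespace SacksSimulation

variable {lam : Cardinal.{u}} {μ : Ordinal.{u} → Cardinal.{u}} {Q : Type v} [Preorder Q]
  (S : SacksSimulation.{u, v} lam μ Q)

/-- The root of the trees. -/
def root : LSeq lam := ⟨S.start, fun _ => S.z⟩

/-- `ν` is a branch of length `i` of the tree built before stage `i`. -/
def Branch (i : Ordinal.{u}) (x : Set.Iio i → SacksRecord lam Q) (ν : LSeq lam) : Prop :=
  ν.len = i ∧ S.start ≤ i ∧ ν.take S.z S.start = S.root ∧
    ∀ j : Set.Iio i, S.start ≤ j → ν.take S.z (j + 1) ∈ (x j).1.top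

theorem Branch.take_eq {S : SacksSimulation.{u, v} lam μ Q} {i : Ordinal.{u}}
    {x : Set.Iio i → SacksRecord lam Q} {ν : LSeq lam} (h : S.Branch i x ν) :
    ν.take S.z i = ν := by
  conv_lhs => rw [← h.1]
  exact LSeq.take_self _ _

/-- The auxiliary play of Incomplete and Complete along `η`. -/
noncomputable def branchPlay (x : Ordinal.{u} → SacksRecord lam Q) (η : LSeq lam) :
    Ordinal.{u} → Q × Q := fun k =>
  ((x (S.start + k)).1.incomplete (η.take S.z (S.start + k + 1)),
    (x (S.start + k)).1.complete (η.take S.z (S.start + k + 1)))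

/-- `m` is a good choice at stage `i`, given the records of the earlier stages. -/
structure IsGood (i : Ordinal.{u}) (x : Set.Iio i → SacksRecord lam Q) (m : SacksMemory lam Q) :
    Prop where
  sys_eq : m.sys = S.strategy i fun j => (x ⟨j.1, j.2.2⟩).round
  len_eq : ∀ η ∈ m.top, η.len = i + 1
  branch : ∀ η ∈ m.top, S.Branch i x (η.take S.z i)
  take_mem : ∀ ν, S.Branch i x ν → ν.take S.z (i + 1) ∈ m.top
  base_le : ∀ η ∈ m.top, S.base ≤ m.incomplete η
  prev_le : ∀ η ∈ m.top, ∀ j : Set.Iio i, S.start ≤ j →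
    (x j).2 (η.take S.z (j + 1)) ≤ m.incomplete η
  complete_eq : ∀ η ∈ m.top, m.complete η = S.completion (i - S.start)
    (fun k => ((x ⟨S.start + k, Ordinal.lt_sub.1 k.2⟩).1.incomplete (η.take S.z (S.start + k + 1)),
      (x ⟨S.start + k, Ordinal.lt_sub.1 k.2⟩).1.complete (η.take S.z (S.start + k + 1))))
    (m.incomplete η)
  incomplete_le : ∀ η ∈ m.top, m.incomplete η ≤ m.complete η
  antichain : ∀ η ∈ m.top, ∀ η' ∈ m.top, η ≠ η' →
    ¬ Compatible (m.complete η) (m.complete η')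
  of_inl : ∀ t η, m.target t = Sum.inl η → η ∈ m.top ∧ m.sys.cond t ≤ m.complete η
  of_inr : ∀ t e, m.target t = Sum.inr e → m.sys.cond t ≤ e ∧
    (i < S.start ∨ ¬ Compatible S.base e ∨
      ∃ j : Set.Iio i, S.start ≤ j ∧ ∀ η ∈ (x j).1.top, ¬ Compatible ((x j).2 η) e)
  card_lt : Cardinal.mk m.top < Cardinal.lift.{u + 1} (μ i)

/-- `x` records a play in which Generic made good choices before stage `k`. -/
def IsRun (x : Ordinal.{u} → SacksRecord lam Q) (k : Ordinal.{u}) : Prop :=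
  ∀ i < k, S.IsGood i (Set.domRestrict (Set.Iio i) x) (x i).1 ∧
    ∀ η ∈ (x i).1.top, (x i).1.complete η ≤ (x i).2 η

variable {S} {x : Ordinal.{u} → SacksRecord lam Q} {k : Ordinal.{u}}

theorem IsRun.snoc {i : Ordinal.{u}} (h : S.IsRun x i) {m : SacksMemory lam Q}
    (hm : S.IsGood i (Set.domRestrict (Set.Iio i) x) m) :
    S.IsRun (Function.update x i (m, m.complete)) (i + 1) := by
  have key : ∀ j ≤ i, Set.domRestrict (Set.Iio j) (Function.update x i (m, m.complete)) =
      Set.domRestrict (Set.Iio j) x := by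
    intro j hj
    funext l
    exact Function.update_of_ne (l.2.trans_le hj).ne _ _
  intro j hj
  rw [Order.lt_add_one_iff] at hj
  rw [key j hj]
  rcases hj.eq_or_lt with rfl | hj
  · rw [Function.update_self]
    exact ⟨hm, fun η _ => le_rfl⟩
  · rw [Function.update_of_ne hj.ne]
    exact h j hj

theorem IsRun.branch_take (h : S.IsRun x k) {i : Ordinal.{u}} {ν : LSeq lam}
    (hν : S.Branch i (Set.domRestrict (Set.Iio i) x) ν) {j : Ordinal.{u}} (hij : i ≤ j)
    (hj : j ≤ k) : S.Branch j (Set.domRestrict (Set.Iio j) x) (ν.take S.z j) := by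
  induction j using WellFoundedLT.induction with
  | ind j ih =>
    refine ⟨rfl, hν.2.1.trans hij, ?_, fun l hl => ?_⟩
    · rw [LSeq.take_take _ _ (Or.inl (hν.2.1.trans hij))]
      exact hν.2.2.1
    · have hlj : l.1 < j := l.2
      rw [LSeq.take_take _ _ (Or.inl (Order.add_one_le_of_lt hlj))]
      rcases lt_or_ge l.1 i with hli | hli
      · exact hν.2.2.2 ⟨l.1, hli⟩ hl
      · have := (h l.1 (hlj.trans_le hj)).1.take_mem _ (ih l.1 hlj hli (hlj.le.trans hj))
        rwa [LSeq.take_take _ _ (Or.inr (hν.1.le.trans hli))] at this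

theorem IsRun.take_mem_top (h : S.IsRun x k) {i j : Ordinal.{u}} (hi : i < k) {η : LSeq lam}
    (hη : η ∈ (x i).1.top) (hj : S.start ≤ j) (hji : j ≤ i) :
    η.take S.z (j + 1) ∈ (x j).1.top := by
  rcases hji.eq_or_lt with rfl | hji
  · rwa [← (h j hi).1.len_eq η hη, LSeq.take_self]
  · have := ((h i hi).1.branch η hη).2.2.2 ⟨j, hji⟩ hj
    rwa [LSeq.take_take _ _ (Or.inl (Order.add_one_le_of_lt hji))] at this

theorem IsRun.reply_mono (h : S.IsRun x k) {i j : Ordinal.{u}} (hi : i < k) {η : LSeq lam}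
    (hη : η ∈ (x i).1.top) (hj : S.start ≤ j) (hji : j ≤ i) :
    (x j).2 (η.take S.z (j + 1)) ≤ (x i).2 η := by
  rcases hji.eq_or_lt with rfl | hji
  · rw [← (h j hi).1.len_eq η hη, LSeq.take_self]
  · exact ((h i hi).1.prev_le η hη ⟨j, hji⟩ hj).trans
      (((h i hi).1.incomplete_le η hη).trans ((h i hi).2 η hη))

theorem IsRun.start_le (h : S.IsRun x k) {i : Ordinal.{u}} (hi : i < k) {η : LSeq lam}
    (hη : η ∈ (x i).1.top) : S.start ≤ i :=
  ((h i hi).1.branch η hη).2.1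

/-- Nodes with compatible replies are comparable. -/
theorem IsRun.take_eq_of_compatible (h : S.IsRun x k) {i j : Ordinal.{u}} (hi : i < k)
    (hji : j ≤ i) {η ν : LSeq lam} (hη : η ∈ (x i).1.top) (hν : ν ∈ (x j).1.top)
    (hc : Compatible ((x j).2 ν) ((x i).2 η)) : η.take S.z (j + 1) = ν := by
  by_contra hne
  have hjk := hji.trans_lt hi
  have hj := h.start_le hjk hν
  have hmem := h.take_mem_top hi hη hj hji
  exact not_compatible_mono ((h j hjk).1.antichain ν hν _ hmem (Ne.symm hne))
    ((h j hjk).2 ν hν) (((h j hjk).2 _ hmem).trans (h.reply_mono hi hη hj hji)) hc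

/-- The simulated play follows the strategy in the game of systems. -/
theorem IsRun.follows (h : S.IsRun x k) :
    (rcAGame lam μ S.base).Follows S.strategy (k := k) fun j => (x j.1).round := by
  intro i
  obtain ⟨hg, hr⟩ := h i.1 i.2.2
  refine ⟨hg.sys_eq, fun t => ?_⟩
  change (x i.1).1.sys.cond t ≤ Sum.elim (x i.1).2 id ((x i.1).1.target t)
  rcases ht : (x i.1).1.target t with η | e
  · exact (hg.of_inl t η ht).2.trans (hr η (hg.of_inl t η ht).1)
  · exact (hg.of_inr t e ht).1

/-- The auxiliary play along a branch is legal and Complete follows her strategy. -/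
theorem IsRun.branchPlay_spec (h : S.IsRun x k) (hc : S.completion.IsWinning lam S.base)
    (hk : k < lam.ord) {η : LSeq lam}
    (hη : S.Branch k (Set.domRestrict (Set.Iio k) x) (η.take S.z k)) :
    (∃ d, S.base ≤ d ∧ ∀ j < k, S.start ≤ j → (x j).2 (η.take S.z (j + 1)) ≤ d) ∧
      ∀ d, S.base ≤ d → (∀ j < k, S.start ≤ j → (x j).2 (η.take S.z (j + 1)) ≤ d) →
        d ≤ S.completion (k - S.start)
          (Set.domRestrict (Set.Iio (k - S.start)) (S.branchPlay x η)) d := by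
  have hmem : ∀ j < k, S.start ≤ j → η.take S.z (j + 1) ∈ (x j).1.top := fun j hj hs => by
    have := hη.2.2.2 ⟨j, hj⟩ hs
    rwa [LSeq.take_take _ _ (Or.inl (Order.add_one_le_of_lt hj))] at this
  have hprev : ∀ i < k, ∀ j < i, S.start ≤ j →
      (x j).2 (η.take S.z (j + 1)) ≤ (x i).1.incomplete (η.take S.z (i + 1)) := by
    intro i hi j hj hs
    have := (h i hi).1.prev_le _ (hmem i hi (hs.trans hj.le)) ⟨j, hj⟩ hs
    rwa [LSeq.take_take _ _ (Or.inl (add_le_add_left hj.le 1))] at this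
  have hlt : ∀ l < k - S.start, S.start + l < k := fun l hl => Ordinal.lt_sub.1 hl
  have hs : ∀ l, S.start ≤ S.start + l := fun l => le_self_add
  obtain ⟨⟨d, hd⟩, hans⟩ := hc (S.branchPlay x η) (k - S.start)
    ((Ordinal.sub_le_self _ _).trans_lt hk)
    ⟨fun l hl => ⟨(h _ (hlt l hl)).1.base_le _ (hmem _ (hlt l hl) (hs l)),
      (h _ (hlt l hl)).1.incomplete_le _ (hmem _ (hlt l hl) (hs l))⟩,
      fun l hl l' hl' => ((h _ (hlt l' (hl'.trans hl))).2 _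
        (hmem _ (hlt l' (hl'.trans hl)) (hs l'))).trans
        (hprev _ (hlt l hl) _ (by simpa using hl') (hs l'))⟩
    (by
      intro l hl
      refine ((h _ (hlt l hl)).1.complete_eq _ (hmem _ (hlt l hl) (hs l))).trans ?_
      have hsub : S.start + l - S.start = l := Ordinal.add_sub_cancel _ _
      have key : ∀ (n : Ordinal.{u}) (f : Set.Iio n → Q × Q), n = l →
          (∀ y : Set.Iio n, f y = S.branchPlay x η y) → ∀ d, S.completion n f d =
            S.completion l (Set.domRestrict (Set.Iio l) (S.branchPlay x η)) d := by
        rintro n f rfl hf d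
        congr 1
        funext y
        exact hf y
      refine key _ _ hsub (fun y => ?_) _
      have hy : S.start + y.1 + 1 ≤ S.start + l + 1 := by
        have : y.1 < l := lt_of_lt_of_eq y.2 hsub
        exact add_le_add_left (by simpa using this.le) 1
      simp only [LSeq.take_take _ _ (Or.inl hy)]
      rfl)
  refine ⟨?_, fun d hd hd' => hans d ⟨hd, fun l hl =>
    ((h _ (hlt l hl)).2 _ (hmem _ (hlt l hl) (hs l))).trans (hd' _ (hlt l hl) (hs l))⟩⟩
  by_cases hsucc : ∃ j, S.start ≤ j ∧ k = j + 1
  · obtain ⟨j, hj, rfl⟩ := hsucc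
    have hjk : j < j + 1 := by simp
    refine ⟨(x j).2 (η.take S.z (j + 1)), ?_, fun l hl hsl => ?_⟩
    · exact ((h j hjk).1.base_le _ (hmem j hjk hj)).trans
        (((h j hjk).1.incomplete_le _ (hmem j hjk hj)).trans ((h j hjk).2 _ (hmem j hjk hj)))
    · have := h.reply_mono hjk (hmem j hjk hj) hsl (Order.lt_add_one_iff.1 hl)
      rwa [LSeq.take_take _ _ (Or.inl (Order.add_one_le_of_lt hl))] at this
  · refine ⟨d, hd.1, fun j hj hsj => ?_⟩
    have hj1 : j + 1 < k := (Order.add_one_le_of_lt hj).lt_of_ne fun he => hsucc ⟨j, hsj, he.symm⟩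
    have hsj1 : S.start ≤ j + 1 := hsj.trans (by simp)
    obtain ⟨l, hl⟩ : ∃ l, S.start + l = j + 1 := ⟨_, Ordinal.add_sub_cancel_of_le hsj1⟩
    have hd2 := hd.2 l (by rw [Ordinal.lt_sub, hl]; exact hj1)
    simp only [branchPlay, hl] at hd2
    exact (hprev _ hj1 j (by simp) hsj).trans
      (((h _ hj1).1.incomplete_le _ (hmem _ hj1 hsj1)).trans hd2)

/-- There are few branches. -/
theorem IsRun.mk_branch_lt (h : S.IsRun x k) (hreg : (μ k).IsRegular)
    (hprod : ∀ f : k.ToType → Ordinal.{u}, (∀ ξ, f ξ < (μ k).ord) →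
      Cardinal.prod (fun ξ => (f ξ).card) < μ k)
    (hmono : ∀ i < k, μ i ≤ μ k) :
    Cardinal.mk {ν // S.Branch k (Set.domRestrict (Set.Iio k) x) ν} <
      Cardinal.lift.{u + 1} (μ k) := by
  classical
  let T : k.ToType → Set (LSeq lam) := fun ξ =>
    if S.start ≤ ξ.toOrd.1 then (x ξ.toOrd.1).1.top else {S.root}
  have hT : ∀ ξ, ∃ κ < μ k, Cardinal.lift.{u + 1} κ = Cardinal.mk (T ξ) := by
    intro ξ
    have hξ : ξ.toOrd.1 < k := ξ.toOrd.2
    refine Cardinal.lt_lift_iff.1 ?_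
    by_cases hs : S.start ≤ ξ.toOrd.1
    · simp only [T, if_pos hs]
      exact (h _ hξ).1.card_lt.trans_le (Cardinal.lift_le.2 (hmono _ hξ))
    · simp only [T, if_neg hs, Cardinal.mk_singleton]
      rw [← Cardinal.lift_one.{u, u + 1}, Cardinal.lift_lt]
      exact Cardinal.one_lt_aleph0.trans_le hreg.aleph0_le
  choose κ hκ hκT using hT
  have hlt := hprod (fun ξ => (κ ξ).ord) fun ξ => Cardinal.ord_lt_ord.2 (hκ ξ)
  simp only [Cardinal.card_ord] at hlt
  refine lt_of_le_of_lt ?_ (Cardinal.lift_lt.2 hlt)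
  rw [Cardinal.lift_prod]
  simp only [hκT]
  rw [← Cardinal.mk_pi]
  let F : {ν // S.Branch k (Set.domRestrict (Set.Iio k) x) ν} → (ξ : k.ToType) → T ξ :=
    fun ν ξ => if hs : S.start ≤ ξ.toOrd.1 then
      ⟨ν.1.take S.z (ξ.toOrd.1 + 1), by
        simp only [T, if_pos hs]
        exact ν.2.2.2.2 ξ.toOrd hs⟩
      else ⟨S.root, by simp [T, if_neg hs]⟩
  have hF : Function.Injective F := by
    intro ν ν' he
    refine Subtype.ext (LSeq.ext_val (ν.2.1.trans ν'.2.1.symm) fun ξ h₁ h₂ => ?_)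
    have hξ : ξ < k := h₁.trans_eq ν.2.1
    rcases lt_or_ge ξ S.start with hs | hs
    · exact LSeq.val_eq_of_take_eq S.z (ν.2.2.2.1.trans ν'.2.2.2.1.symm) hs h₁ h₂
    · have := congrArg Subtype.val (congrFun he (Ordinal.ToType.mk ⟨ξ, hξ⟩))
      simp only [F, OrderIso.symm_apply_apply, dif_pos hs] at this
      exact LSeq.val_eq_of_take_eq S.z this (by simp) h₁ h₂
  exact Cardinal.mk_le_of_injective hF

end SacksSimulation

namespace SacksSimulation

variable {lam : Cardinal.{u}} {μ : Ordinal.{u} → Cardinal.{u}} {Q : Type v} [Preorder Q]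
  {S : SacksSimulation.{u, v} lam μ Q} {x : Ordinal.{u} → SacksRecord lam Q} {k : Ordinal.{u}}

/-- A condition that is above a reply at each level determines a branch. -/
theorem IsRun.exists_branch (h : S.IsRun x k) (hs : S.start ≤ k) {q : Q}
    (hq : ∀ j < k, S.start ≤ j → ∃ η ∈ (x j).1.top, (x j).2 η ≤ q) :
    ∃ ν, S.Branch k (Set.domRestrict (Set.Iio k) x) ν ∧
      ∀ j < k, S.start ≤ j → (x j).2 (ν.take S.z (j + 1)) ≤ q := by
  classical
  have : Nonempty (LSeq lam) := ⟨S.root⟩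
  choose! η hη hηq using hq
  let ν : LSeq lam := ⟨k, fun ξ => if hξ : S.start ≤ ξ.1 then
    (η ξ.1).val ⟨ξ.1, by
      have : ξ.1 < (η ξ.1).len := by
        rw [(h ξ.1 ξ.2).1.len_eq _ (hη ξ.1 ξ.2 hξ)]
        simp
      exact this⟩ else S.z⟩
  have hν : ∀ j < k, S.start ≤ j → ν.take S.z (j + 1) = η j := by
    intro j hj hsj
    have hlen := (h j hj).1.len_eq _ (hη j hj hsj)
    refine LSeq.ext_val hlen.symm fun ξ h₁ h₂ => ?_
    have hξj : ξ < j + 1 := h₁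
    have hξk : ξ < k := (Order.lt_add_one_iff.1 hξj).trans_lt hj
    refine (LSeq.take_val_of_lt S.z ν hξj hξk).trans ?_
    by_cases hsξ : S.start ≤ ξ
    · have hξl : ξ < (η ξ).len := by
        rw [(h ξ hξk).1.len_eq _ (hη ξ hξk hsξ)]
        simp
      have h1 : ν.val ⟨ξ, hξk⟩ = (η ξ).val ⟨ξ, hξl⟩ := dif_pos hsξ
      rw [h1]
      have h2 := h.take_eq_of_compatible hj (Order.lt_add_one_iff.1 hξj) (hη j hj hsj)
        (hη ξ hξk hsξ) ⟨q, hηq ξ hξk hsξ, hηq j hj hsj⟩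
      refine LSeq.val_eq_of_take_eq S.z (k := ξ + 1) ?_ (by simp) hξl h₂
      rw [h2, ← (h ξ hξk).1.len_eq _ (hη ξ hξk hsξ), LSeq.take_self]
    · have h1 : ν.val ⟨ξ, hξk⟩ = S.z := dif_neg hsξ
      rw [h1]
      have hb := ((h j hj).1.branch _ (hη j hj hsj)).2.2.1
      rw [LSeq.take_take _ _ (Or.inl hsj)] at hb
      have hξs := not_le.1 hsξ
      have h2 := LSeq.val_eq_of_take_eq S.z (ν := η j) (η := S.root) (k := S.start) (ξ := ξ)
        (by rw [hb]; exact (LSeq.take_self S.z S.root).symm) hξs h₂ hξs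
      rw [h2]
      rfl
  refine ⟨ν, ⟨rfl, hs, ?_, fun j hsj => ?_⟩, fun j hj hsj => ?_⟩
  · refine LSeq.ext_val rfl fun ξ h₁ h₂ => ?_
    have hξ : ξ < S.start := h₁
    refine (LSeq.take_val_of_lt S.z ν hξ (hξ.trans_le hs)).trans ?_
    exact dif_neg hξ.not_ge
  · rw [hν j.1 j.2 hsj]
    exact hη j.1 j.2 hsj
  · rw [hν j hj hsj]
    exact hηq j hj hsj

theorem exists_injective_ne {I : Type u} (hlam : Cardinal.aleph0 ≤ lam)
    (hI : Cardinal.mk I < lam) (z : Set.Iio lam.ord) :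
    ∃ e : I → Set.Iio lam.ord, Function.Injective e ∧ ∀ t, e t ≠ z := by
  classical
  obtain ⟨g⟩ : Nonempty (Option I ↪ Set.Iio lam.ord) := by
    rw [← Cardinal.lift_mk_le']
    have h1 : Cardinal.mk (Option I) ≤ lam := by
      rw [Cardinal.mk_option]
      exact (Cardinal.add_lt_of_lt hlam hI (Cardinal.one_lt_aleph0.trans_le hlam)).le
    simpa using Cardinal.lift_le.{u + 1}.2 h1
  refine ⟨fun t => Equiv.swap (g none) z (g (some t)), fun t s hts => ?_, fun t ht => ?_⟩
  · simpa using hts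
  · have h1 : Equiv.swap (g none) z (g (some t)) = Equiv.swap (g none) z (g none) := by
      rw [Equiv.swap_apply_left]
      exact ht
    exact absurd (g.injective ((Equiv.swap _ _).injective h1)) (by simp)

/-- A good choice exists at each stage. -/
theorem IsRun.exists_isGood (h : S.IsRun x k) (hlam : Cardinal.aleph0 ≤ lam) (hk : k < lam.ord)
    (hQ : StrategicallyComplete lam Q) (hat : Atomless Q)
    (hc : S.completion.IsWinning lam S.base)
    (hstrat : (rcAGame lam μ S.base).IsWinning S.strategy)
    (hreg : (μ k).IsRegular) (hle : μ k ≤ lam)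
    (hprod : ∀ f : k.ToType → Ordinal.{u}, (∀ ξ, f ξ < (μ k).ord) →
      Cardinal.prod (fun ξ => (f ξ).card) < μ k)
    (hmono : ∀ i < k, μ i ≤ μ k) :
    ∃ m, S.IsGood k (Set.domRestrict (Set.Iio k) x) m := by
  classical
  have hB := h.mk_branch_lt hreg hprod hmono
  have hsmall := Cardinal.small_of_lt_lift hB
  let B := {ν // S.Branch k (Set.domRestrict (Set.Iio k) x) ν}
  let sys : SystemMove.{u} Q := S.strategy k fun j => (x j.1).round
  have hsys : Cardinal.mk sys.I < μ k := (hstrat.1 k zero_le hk _ h.follows).2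
  let J := sys.I ⊕ Shrink.{u} B
  have hJμ : Cardinal.mk J < μ k := by
    rw [Cardinal.mk_sum, Cardinal.lift_id, Cardinal.lift_id]
    exact Cardinal.add_lt_of_lt hreg.aleph0_le hsys (Cardinal.mk_shrink_lt hB)
  have hd : ∀ ν : B, ∃ d, S.base ≤ d ∧
      ∀ j < k, S.start ≤ j → (x j).2 (ν.1.take S.z (j + 1)) ≤ d := by
    intro ν
    refine (h.branchPlay_spec hc hk ?_).1
    rw [ν.2.take_eq]
    exact ν.2
  choose d hd using hd
  obtain ⟨f, hf, hanti, hdec⟩ := hQ.exists_antichain hlam hat (J := J) (K := Option k.ToType)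
    (hJμ.trans_le hle)
    (by
      rw [Cardinal.mk_option, Cardinal.mk_toType]
      exact Cardinal.add_lt_of_lt hlam (Cardinal.lt_ord.1 hk)
        (Cardinal.one_lt_aleph0.trans_le hlam))
    (fun o => o.elim {q | S.base ≤ q ∨ ¬ Compatible S.base q}
      fun ξ => {q | (∃ η ∈ (x ξ.toOrd.1).1.top, (x ξ.toOrd.1).2 η ≤ q) ∨
        ∀ η ∈ (x ξ.toOrd.1).1.top, ¬ Compatible ((x ξ.toOrd.1).2 η) q})
    (by
      rintro (_ | ξ) p q hpq (hp | hp)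
      · exact Or.inl (hp.trans hpq)
      · exact Or.inr (not_compatible_mono hp le_rfl hpq)
      · obtain ⟨η, hη, hp⟩ := hp
        exact Or.inl ⟨η, hη, hp.trans hpq⟩
      · exact Or.inr fun η hη => not_compatible_mono (hp η hη) le_rfl hpq)
    (by
      rintro (_ | ξ) p
      · by_cases hp : Compatible S.base p
        · obtain ⟨r, hr, hpr⟩ := hp
          exact ⟨r, hpr, Or.inl hr⟩
        · exact ⟨p, le_rfl, Or.inr hp⟩
      · by_cases hp : ∃ η ∈ (x ξ.toOrd.1).1.top, Compatible ((x ξ.toOrd.1).2 η) p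
        · obtain ⟨η, hη, r, hr, hpr⟩ := hp
          exact ⟨r, hpr, Or.inl ⟨η, hη, hr⟩⟩
        · exact ⟨p, le_rfl, Or.inr fun η hη hc => hp ⟨η, hη, hc⟩⟩)
    (Sum.elim sys.cond fun ν => d ((equivShrink _).symm ν))
  obtain ⟨e, he, hez⟩ := exists_injective_ne hlam (hsys.trans_le hle) S.z
  let Par : J → LSeq lam → Prop := fun y ν =>
    S.Branch k (Set.domRestrict (Set.Iio k) x) ν ∧ S.base ≤ f y ∧
      ∀ j < k, S.start ≤ j → (x j).2 (ν.take S.z (j + 1)) ≤ f y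
  let par : J → LSeq lam := Sum.elim (fun t => Classical.epsilon (h := ⟨S.root⟩) (Par (Sum.inl t)))
    fun ν => ((equivShrink B).symm ν).1
  let lab : J → Set.Iio lam.ord := Sum.elim e fun _ => S.z
  let node : J → LSeq lam := fun y => (par y).child (lab y)
  have hnode : Function.Injective node := by
    intro y y' hy
    obtain ⟨h1, h2⟩ := LSeq.child_injective hy
    rcases y with t | ν <;> rcases y' with t' | ν'
    · exact congrArg Sum.inl (he h2)
    · exact absurd h2 (hez t)
    · exact absurd h2.symm (hez t')
    · exact congrArg Sum.inr ((equivShrink B).symm.injective (Subtype.ext h1))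
  have hparr : ∀ ν : Shrink.{u} B, Par (Sum.inr ν) (par (Sum.inr ν)) := fun ν =>
    ⟨((equivShrink B).symm ν).2, (hd _).1.trans (hf (Sum.inr ν)),
      fun j hj hsj => ((hd _).2 j hj hsj).trans (hf (Sum.inr ν))⟩
  have hparl : ∀ t, Par (Sum.inl t) (par (Sum.inl t)) ∨ (k < S.start ∨
      ¬ Compatible S.base (f (Sum.inl t)) ∨ ∃ j : Set.Iio k, S.start ≤ j ∧
        ∀ η ∈ (x j).1.top, ¬ Compatible ((x j).2 η) (f (Sum.inl t))) := by
    intro t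
    by_contra! hcon
    obtain ⟨h1, h2, h3, h4⟩ := hcon
    have hbase : S.base ≤ f (Sum.inl t) := by
      rcases hdec (Sum.inl t) none with hb | hb
      · exact hb
      · exact absurd h3 hb
    obtain ⟨ν, hν, hνq⟩ := h.exists_branch h2 (q := f (Sum.inl t)) (by
      intro j hj hsj
      have := hdec (Sum.inl t) (some (Ordinal.ToType.mk ⟨j, hj⟩))
      simp only [Option.elim_some, OrderIso.symm_apply_apply, Set.mem_ofPred_eq] at this
      rcases this with hb | hb
      · exact hb
      · obtain ⟨η, hη, hc⟩ := h4 ⟨j, hj⟩ hsj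
        exact absurd hc (hb η hη))
    exact h1 (Classical.epsilon_spec (p := Par (Sum.inl t)) ⟨ν, hν, hbase, hνq⟩)
  let top : Set (LSeq lam) := {η | ∃ y, Par y (par y) ∧ node y = η}
  let inc : LSeq lam → Q := fun η => if hη : ∃ y, node y = η then f hη.choose else S.base
  have hinc : ∀ y, inc (node y) = f y := by
    intro y
    have hy : ∃ y', node y' = node y := ⟨y, rfl⟩
    simp only [inc, dif_pos hy]
    rw [hnode hy.choose_spec]
  let comp : LSeq lam → Q := fun η => S.completion (k - S.start)
    (Set.domRestrict (Set.Iio (k - S.start)) (S.branchPlay x η)) (inc η)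
  have hlen : ∀ y, Par y (par y) → (node y).len = k + 1 := fun y hy => by
    change (par y).len + 1 = k + 1
    rw [hy.1.1]
  have htake : ∀ y, Par y (par y) → ∀ j ≤ k, (node y).take S.z j = (par y).take S.z j :=
    fun y hy j hj => LSeq.child_take S.z _ _ (by rw [hy.1.1]; exact hj)
  have hbr : ∀ y, Par y (par y) → S.Branch k (Set.domRestrict (Set.Iio k) x)
      ((node y).take S.z k) := fun y hy => by
    rw [htake y hy k le_rfl, hy.1.take_eq]
    exact hy.1
  have hprev : ∀ y, Par y (par y) → ∀ j < k, S.start ≤ j →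
      (x j).2 ((node y).take S.z (j + 1)) ≤ f y := fun y hy j hj hsj => by
    rw [htake y hy _ (Order.add_one_le_of_lt hj)]
    exact hy.2.2 j hj hsj
  have hcomp : ∀ y, Par y (par y) → f y ≤ comp (node y) := fun y hy => by
    have := (h.branchPlay_spec hc hk (hbr y hy)).2 (f y) hy.2.1 (hprev y hy)
    simpa only [comp, hinc] using this
  refine ⟨⟨top, inc, comp, sys, fun t => if Par (Sum.inl t) (par (Sum.inl t)) then
    Sum.inl (node (Sum.inl t)) else Sum.inr (f (Sum.inl t))⟩, ?_⟩
  constructor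
  · rfl
  · rintro _ ⟨y, hy, rfl⟩
    exact hlen y hy
  · rintro _ ⟨y, hy, rfl⟩
    exact hbr y hy
  · intro ν hν
    refine ⟨Sum.inr (equivShrink B ⟨ν, hν⟩), hparr _, ?_⟩
    simp only [node, par, lab, Sum.elim_inr, Equiv.symm_apply_apply, LSeq.child]
    rw [hν.1]
  · rintro _ ⟨y, hy, rfl⟩
    simp only [hinc]
    exact hy.2.1
  · rintro _ ⟨y, hy, rfl⟩ j hsj
    simp only [hinc]
    exact hprev y hy j.1 j.2 hsj
  · rintro _ ⟨y, hy, rfl⟩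
    rfl
  · rintro _ ⟨y, hy, rfl⟩
    simp only [hinc]
    exact hcomp y hy
  · rintro _ ⟨y, hy, rfl⟩ _ ⟨y', hy', rfl⟩ hne
    exact not_compatible_mono (hanti y y' fun hyy => hne (by rw [hyy])) (hcomp y hy) (hcomp y' hy')
  · intro t η ht
    simp only at ht
    split_ifs at ht with hp
    obtain rfl := Sum.inl_injective ht
    exact ⟨⟨_, hp, rfl⟩, (hf (Sum.inl t)).trans (hcomp _ hp)⟩
  · intro t q ht
    simp only at ht
    split_ifs at ht with hp
    obtain rfl := Sum.inr_injective ht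
    exact ⟨hf (Sum.inl t), (hparl t).resolve_left hp⟩
  · refine lt_of_le_of_lt ?_ (Cardinal.lift_lt.{u, u + 1}.2 hJμ)
    have h1 : top ⊆ Set.range node := by
      rintro _ ⟨y, -, rfl⟩
      exact ⟨y, rfl⟩
    refine (Cardinal.mk_le_mk_of_subset h1).trans ?_
    have h2 := Cardinal.mk_range_le_lift (f := node)
    rwa [Cardinal.lift_id'.{u, u + 1}] at h2

end SacksSimulation

namespace SacksSimulation

/-! ### Replies as functions on all sequences -/

section Reply

variable {lam : Cardinal.{u}} {Q : Type v}

open Classical in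
/-- The replies of Antigeneric as a function on all sequences. -/
noncomputable def replyFun {i : Ordinal.{u}} (p : Q)
    (R : (m : SacksMove lam Q i) × (TopLevel m.tree i → Q)) (η : LSeq lam) : Q :=
  if h : η ∈ R.1.tree ∧ η.len = i + 1 then R.2 ⟨η, h⟩ else p

theorem replyFun_of_mem {i : Ordinal.{u}} (p : Q)
    (R : (m : SacksMove lam Q i) × (TopLevel m.tree i → Q)) (η : TopLevel R.1.tree i) :
    replyFun p R η.1 = R.2 η := dif_pos η.2

end Reply

variable {lam : Cardinal.{u}} {μ : Ordinal.{u} → Cardinal.{u}} {Q : Type v} [Preorder Q]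
  {S : SacksSimulation.{u, v} lam μ Q} {x : Ordinal.{u} → SacksRecord lam Q} {k : Ordinal.{u}}

/-! ### The moves obtained from the simulation are legal -/

variable (S) in
/-- The tree generated by the top level. -/
def tree (m : SacksMemory lam Q) : Set (LSeq lam) :=
  {η | S.start ≤ η.len ∧ ∃ ν ∈ m.top, η.IsInitial ν}

variable (S) in
/-- The move in the Sacks game determined by what Generic remembers. -/
def toMove (i : Ordinal.{u}) (m : SacksMemory lam Q) : SacksMove lam Q i :=
  ⟨S.tree m, fun η => m.complete η.1⟩

theorem IsRun.mem_tree_of_mem_top (h : S.IsRun x k) {i j : Ordinal.{u}} (hi : i < k) (hji : j ≤ i)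
    {η : LSeq lam} (hη : η ∈ (x j).1.top) : η ∈ S.tree (x i).1 := by
  have hjk := hji.trans_lt hi
  have hs := h.start_le hjk hη
  have hlen := (h j hjk).1.len_eq η hη
  refine ⟨hlen ▸ hs.trans (by simp), ?_⟩
  rcases hji.eq_or_lt with rfl | hji
  · exact ⟨η, hη, le_rfl, fun _ => rfl⟩
  · have hb : S.Branch (j + 1) (Set.domRestrict (Set.Iio (j + 1)) x) η := by
      refine ⟨hlen, hs.trans (by simp), ?_, fun l hl => ?_⟩
      · have := ((h j hjk).1.branch η hη).2.2.1
        rwa [LSeq.take_take _ _ (Or.inl hs)] at this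
      · exact h.take_mem_top hjk hη hl (Order.lt_add_one_iff.1 l.2)
    have hb' := h.branch_take hb (Order.add_one_le_of_lt hji) hi.le
    have hm := (h i hi).1.take_mem _ hb'
    rw [LSeq.take_take _ _ (Or.inr (hlen.le.trans (Order.add_one_le_of_lt hji)))] at hm
    exact ⟨_, hm, LSeq.isInitial_take_of_le _ _ (hlen.le.trans (add_le_add_left hji.le 1))⟩

theorem IsRun.mem_top_of_mem_tree (h : S.IsRun x k) {i j : Ordinal.{u}} (hi : i < k)
    (hs : S.start ≤ j) (hji : j ≤ i) {η : LSeq lam} (hη : η ∈ S.tree (x i).1)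
    (hlen : η.len = j + 1) : η ∈ (x j).1.top := by
  obtain ⟨-, ν, hν, hi'⟩ := hη
  have := h.take_mem_top hi hν hs hji
  rwa [← hlen, ((LSeq.isInitial_iff S.z).1 hi').2] at this

theorem IsRun.tree_eq (h : S.IsRun x k) {i j : Ordinal.{u}} (hi : i < k) (hs : S.start ≤ j)
    (hji : j ≤ i) : S.tree (x j).1 = {η ∈ S.tree (x i).1 | η.len ≤ j + 1} := by
  have hjk := hji.trans_lt hi
  ext η
  constructor
  · rintro ⟨hsη, ν, hν, hην⟩
    obtain ⟨-, θ, hθ, hνθ⟩ := h.mem_tree_of_mem_top hi hji hν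
    exact ⟨⟨hsη, θ, hθ, hην.trans hνθ⟩, hην.1.trans ((h j hjk).1.len_eq ν hν).le⟩
  · rintro ⟨⟨hsη, ν, hν, hην⟩, hle⟩
    refine ⟨hsη, _, h.take_mem_top hi hν hs hji, ?_⟩
    rw [LSeq.isInitial_iff S.z, LSeq.take_take _ _ (Or.inl hle)]
    exact ⟨hle, ((LSeq.isInitial_iff S.z).1 hην).2⟩

theorem IsRun.isRoot (h : S.IsRun x k) {i : Ordinal.{u}} (hi : i < k) (hs : S.start ≤ i) :
    LSeq.IsRoot (S.tree (x i).1) S.root := by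
  have hroot : S.root.take S.z S.start = S.root := LSeq.take_self S.z S.root
  have hb : S.Branch S.start (Set.domRestrict (Set.Iio S.start) x) S.root :=
    ⟨rfl, le_rfl, hroot, fun j hj => absurd j.2 hj.not_gt⟩
  have hm := (h i hi).1.take_mem _ (h.branch_take hb hs hi.le)
  have hs1 : S.start ≤ i + 1 := hs.trans (by simp)
  rw [LSeq.take_take _ _ (Or.inr hs)] at hm
  refine ⟨⟨le_rfl, _, hm, LSeq.isInitial_take_of_le S.z S.root hs1⟩, ?_⟩
  rintro η ⟨hsη, ν, hν, hην⟩
  rw [LSeq.isInitial_iff S.z]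
  refine ⟨hsη, ?_⟩
  have h1 := ((h i hi).1.branch ν hν).2.2.1
  rw [LSeq.take_take _ _ (Or.inl hs)] at h1
  rw [← h1]
  exact (hην.take_eq S.z hsη).symm

theorem IsRun.isCompleteTree (h : S.IsRun x k) {i : Ordinal.{u}} (hi : i < k)
    (hs : S.start ≤ i) : IsCompleteTree (S.tree (x i).1) (i + 1) where
  exists_root := ⟨_, h.isRoot hi hs⟩
  initial_mem := by
    rintro r hr η ⟨hsη, ν, hν, hην⟩ θ hθ hlt
    have : S.start ≤ r.len := hr.1.1
    exact ⟨this.trans hlt.le, ν, hν, hθ.trans hην⟩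
  union_mem := by
    rintro C hC ⟨θ, hθ⟩ - η ⟨hin, hcov⟩
    have hsη : S.start ≤ η.len := (hC hθ).1.trans (hin θ hθ).1
    have htop : ∀ j < η.len, S.start ≤ j → j ≤ i → η.take S.z (j + 1) ∈ (x j).1.top := by
      intro j hj hsj hji
      obtain ⟨ν, hν, hjν⟩ := hcov j hj
      have hjν' := Order.add_one_le_of_lt hjν
      rw [(hin ν hν).take_eq S.z hjν']
      obtain ⟨-, τ, hτ, hντ⟩ := hC hν
      exact h.mem_top_of_mem_tree hi hsj hji
        ⟨hsj.trans (by simp), τ, hτ, (LSeq.isInitial_take S.z ν hjν').trans hντ⟩ rfl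
    rcases lt_or_ge i η.len with hlt | hle
    · have hlen : η.len ≤ i + 1 := by
        by_contra hcon
        obtain ⟨ν', hν', hiν'⟩ := hcov (i + 1) (not_le.1 hcon)
        obtain ⟨-, τ', hτ', hντ'⟩ := hC hν'
        exact (hντ'.1.trans ((h i hi).1.len_eq τ' hτ').le).not_gt hiν'
      have h1 := htop i hlt hs le_rfl
      rw [← le_antisymm hlen (Order.add_one_le_of_lt hlt), LSeq.take_self] at h1
      exact h.mem_tree_of_mem_top hi le_rfl h1
    · have hb : S.Branch η.len (Set.domRestrict (Set.Iio η.len) x) η := by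
        refine ⟨rfl, hsη, ?_, fun j hj => htop j.1 j.2 hj (j.2.le.trans hle)⟩
        rw [(hin θ hθ).take_eq S.z (hC hθ).1]
        exact ((LSeq.isInitial_iff S.z).1 ((h.isRoot hi hs).2 θ (hC hθ))).2
      have hm := (h i hi).1.take_mem _ (h.branch_take hb hle hi.le)
      rw [LSeq.take_take _ _ (Or.inr hle)] at hm
      exact ⟨hsη, _, hm, LSeq.isInitial_take_of_le S.z η (hle.trans (by simp))⟩
  len_le := by
    rintro η ⟨-, ν, hν, hην⟩
    exact hην.1.trans ((h i hi).1.len_eq ν hν).le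
  exists_extension := by
    rintro η ⟨-, ν, hν, hην⟩
    exact ⟨ν, h.mem_tree_of_mem_top hi le_rfl hν, hην, (h i hi).1.len_eq ν hν⟩

/-! ### Plays that follow the simulation are won -/

/-- The name for the generic branch. -/
def branchName (x : Ordinal.{u} → SacksRecord lam Q) :
    Forcing.SubsetName (Set.Iio lam.ord × Set.Iio lam.ord) Q :=
  {y | ∃ i < lam.ord, ∃ η ∈ (x i).1.top, ∃ h : y.1.1.1 < η.len, η.val ⟨y.1.1.1, h⟩ = y.1.2 ∧
    y.2 = (x i).2 η}

/-- Some node of each level has its reply in the generic filter. -/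
theorem IsRun.exists_reply_le (h : S.IsRun x lam.ord) {p : Q} (hbase : S.base ≤ p)
    (hp : ∀ α : Set.Ico 0 lam.ord, Forcing.ex (fun t : (x α.1).1.sys.I =>
      Forcing.inGeneric ((x α.1).round.2 t)) p) {i : Ordinal.{u}} (hi : i < lam.ord)
    (hs : S.start ≤ i) {r : Q} (hr : p ≤ r) : ∃ s, r ≤ s ∧ ∃ η ∈ (x i).1.top, (x i).2 η ≤ s := by
  induction i using WellFoundedLT.induction generalizing r with
  | ind i ih =>
    obtain ⟨s, hrs, t, ht⟩ := hp ⟨i, zero_le, hi⟩ r hr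
    obtain ⟨s', hss', hts'⟩ := ht s le_rfl
    change Sum.elim (x i).2 id ((x i).1.target t) ≤ s' at hts'
    rcases htt : (x i).1.target t with η | e
    · rw [htt] at hts'
      exact ⟨s', hrs.trans hss', η, ((h i hi).1.of_inl t η htt).1, hts'⟩
    · rw [htt] at hts'
      have hps' : p ≤ s' := hr.trans (hrs.trans hss')
      exfalso
      rcases ((h i hi).1.of_inr t e htt).2 with hlt | hc | ⟨j, hj, hc⟩
      · exact hs.not_gt hlt
      · exact hc ⟨s', hbase.trans hps', hts'⟩
      · obtain ⟨s'', hs'', η, hη, hηs⟩ := ih j.1 j.2 (j.2.trans hi) hj hps'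
        exact hc η hη ⟨s'', hηs, hts'.trans hs''⟩

theorem IsRun.exists_name (hstart : S.start < lam.ord)
    (h : S.IsRun x lam.ord)
    (hstrat : (rcAGame lam μ S.base).IsWinning S.strategy) :
    ∃ q, S.base ≤ q ∧ Forcing.isFunction (branchName x) q ∧
      ∀ i < lam.ord, S.start ≤ i → ∀ r, q ≤ r → ∃ s, r ≤ s ∧ ∃ η ∈ (x i).1.top,
        (∀ (j : Set.Iio lam.ord) (hj : j.1 < η.len),
          Forcing.mem (j, η.val ⟨j, hj⟩) (branchName x) s) ∧
        Forcing.inGeneric ((x i).2 η) s := by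
  obtain ⟨q, hq, hforce⟩ := hstrat.2 _ h.follows
  have hgen : ∀ {a s : Q}, a ≤ s → Forcing.inGeneric a s := fun has r hr =>
    ⟨r, le_rfl, has.trans hr⟩
  have hmem : ∀ {i} (_ : i < lam.ord) {η} (_ : η ∈ (x i).1.top) {s} (_ : (x i).2 η ≤ s)
      (j : Set.Iio lam.ord) (hj : j.1 < η.len),
      Forcing.mem (j, η.val ⟨j, hj⟩) (branchName x) s := by
    intro i hi η hη s hs j hj r hr
    exact ⟨r, le_rfl, ⟨_, i, hi, η, hη, hj, rfl, rfl⟩, hgen (hs.trans hr)⟩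
  refine ⟨q, hq, ⟨fun j r hr => ?_, ?_⟩, fun i hi hs r hr => ?_⟩
  · have hmax : max j.1 S.start < lam.ord := max_lt j.2 hstart
    obtain ⟨s, hrs, η, hη, hηs⟩ := h.exists_reply_le hq hforce hmax (le_max_right _ _) hr
    have hj : j.1 < η.len := by
      rw [(h _ hmax).1.len_eq η hη, Order.lt_add_one_iff]
      exact le_max_left _ _
    exact ⟨s, hrs, η.val ⟨j.1, hj⟩, hmem hmax hη hηs j hj⟩
  · rintro j y z r hr ⟨h₁, h₂⟩
    obtain ⟨s₁, hs₁, ⟨⟨a₁, i₁, hi₁, η₁, hη₁, hj₁, hv₁, he₁⟩, hg₁⟩⟩ := h₁ r le_rfl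
    obtain ⟨s₂, hs₂, ⟨⟨a₂, i₂, hi₂, η₂, hη₂, hj₂, hv₂, he₂⟩, hg₂⟩⟩ := h₂ s₁ hs₁
    obtain ⟨s₃, hs₃, ha₂⟩ := hg₂ s₂ le_rfl
    obtain ⟨s₄, hs₄, ha₁⟩ := hg₁ s₃ (hs₂.trans hs₃)
    dsimp only at hv₁ he₁ hv₂ he₂ ha₁ ha₂ hj₁ hj₂
    subst he₁ he₂
    have key : ∀ {i₁ i₂ η₁ η₂} (_ : i₂ < lam.ord) (_ : i₁ ≤ i₂) (_ : η₁ ∈ (x i₁).1.top)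
        (_ : η₂ ∈ (x i₂).1.top) (hj₁ : j.1 < η₁.len) (hj₂ : j.1 < η₂.len)
        (_ : (x i₁).2 η₁ ≤ s₄) (_ : (x i₂).2 η₂ ≤ s₄),
        η₁.val ⟨j.1, hj₁⟩ = η₂.val ⟨j.1, hj₂⟩ := by
      intro i₁ i₂ η₁ η₂ hi₂ hle hη₁ hη₂ hj₁ hj₂ hl₁ hl₂
      have h1 := h.take_eq_of_compatible hi₂ hle hη₂ hη₁ ⟨s₄, hl₁, hl₂⟩
      have hlen := (h i₁ (hle.trans_lt hi₂)).1.len_eq η₁ hη₁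
      refine LSeq.val_eq_of_take_eq S.z (k := i₁ + 1) ?_ (hlen ▸ hj₁) hj₁ hj₂
      rw [h1, ← hlen, LSeq.take_self]
    change y = z
    rw [← hv₁, ← hv₂]
    rcases le_total i₁ i₂ with hle | hle
    · exact key hi₂ hle hη₁ hη₂ hj₁ hj₂ ha₁ (ha₂.trans hs₄)
    · exact (key hi₁ hle hη₂ hη₁ hj₂ hj₁ (ha₂.trans hs₄) ha₁).symm
  · obtain ⟨s, hrs, η, hη, hηs⟩ := h.exists_reply_le hq hforce hi hs hr
    exact ⟨s, hrs, η, hη, fun j hj => hmem hi hη hηs j hj, hgen hηs⟩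

/-! ### The strategy in the Sacks game -/

theorem le_replyFun {i : Ordinal.{u}} (p : Q)
    (R : (m : SacksMove lam Q i) × (TopLevel m.tree i → Q)) {m : SacksMemory lam Q}
    (hm : R.1 = S.toMove i m) (hR : ∀ η, R.1.cond η ≤ R.2 η) {η : LSeq lam}
    (hη : η ∈ S.tree m) (hlen : η.len = i + 1) : m.complete η ≤ replyFun p R η := by
  obtain ⟨m', r⟩ := R
  obtain rfl : m' = _ := hm
  rw [replyFun_of_mem p ⟨S.toMove i m, r⟩ ⟨η, hη, hlen⟩]
  exact hR ⟨η, hη, hlen⟩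

/-- Generic has a winning strategy in the Sacks game. -/
theorem genericHasWinningStrategy (S : SacksSimulation.{u, v} lam μ Q)
    (hlam : Cardinal.aleph0 ≤ lam) (hstart : S.start < lam.ord)
    (hQ : StrategicallyComplete lam Q) (hat : Atomless Q)
    (hc : S.completion.IsWinning lam S.base)
    (hstrat : (rcAGame lam μ S.base).IsWinning S.strategy)
    (hreg : ∀ α < lam.ord, (μ α).IsRegular) (hle : ∀ α < lam.ord, μ α ≤ lam)
    (hprod : ∀ α < lam.ord, ∀ f : α.ToType → Ordinal.{u}, (∀ ξ, f ξ < (μ α).ord) →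
      Cardinal.prod (fun ξ => (f ξ).card) < μ α)
    (hmono : ∀ j < lam.ord, ∀ i < j, μ i ≤ μ j) :
    (sacksGame lam μ S.start S.base).GenericHasWinningStrategy := by
  classical
  let G := sacksGame lam μ S.start S.base
  have : Nonempty (SacksMemory lam Q) :=
    ⟨∅, fun _ => S.base, fun _ => S.base, ⟨PEmpty, PEmpty.elim⟩, fun t => PEmpty.elim t⟩
  let cut : {k : Ordinal.{u}} → G.History k → (j : Ordinal.{u}) → j < k → G.History j :=
    fun h j hj l => h ⟨l.1, l.2.1, l.2.2.trans hj⟩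
  let record : {k : Ordinal.{u}} → G.History k → (j : Ordinal.{u}) → j < k → SacksMemory lam Q →
      SacksRecord lam Q := fun h j hj m =>
    (m, if hs : S.start ≤ j then replyFun S.base (h ⟨j, hs, hj⟩) else m.complete)
  let mem : (i : Ordinal.{u}) → G.History i → SacksMemory lam Q := fun i =>
    WellFoundedLT.fix (motive := fun i => G.History i → SacksMemory lam Q)
      (fun i ih h => Classical.epsilon (S.IsGood i fun j =>
        record h j.1 j.2 (ih j.1 j.2 (cut h j.1 j.2)))) i
  have hmem : ∀ i (h : G.History i), mem i h = Classical.epsilon (S.IsGood i fun j =>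
      record h j.1 j.2 (mem j.1 (cut h j.1 j.2))) := fun i h =>
    congrFun (WellFoundedLT.fix_eq (motive := fun i => G.History i → SacksMemory lam Q) _ i) h
  let run : {k : Ordinal.{u}} → G.History k → Ordinal.{u} → SacksRecord lam Q := fun {k} h j =>
    if hj : j < k then record h j hj (mem j (cut h j hj)) else (Classical.arbitrary _, fun _ => S.base)
  have hrun : ∀ {k} (h : G.History k) {j} (hj : j < k),
      run h j = record h j hj (mem j (cut h j hj)) := fun h j hj => dif_pos hj
  let σ : G.Strategy := fun i h => S.toMove i (mem i h)
  have hgood : ∀ {k} (h : G.History k), k < lam.ord → S.IsRun (run h) k →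
      S.IsGood k (Set.domRestrict (Set.Iio k) (run h)) (mem k h) := by
    intro k h hk hr
    have hex := hr.exists_isGood hlam hk hQ hat hc hstrat (hreg k hk) (hle k hk) (hprod k hk)
      (hmono k hk)
    have hpast : (fun j : Set.Iio k => record h j.1 j.2 (mem j.1 (cut h j.1 j.2))) =
        Set.domRestrict (Set.Iio k) (run h) := funext fun j => (hrun h j.2).symm
    rw [hmem, hpast]
    exact Classical.epsilon_spec hex
  have hcut : ∀ {k} (h : G.History k) {i} (hi : i < k),
      Set.domRestrict (Set.Iio i) (run (cut h i hi)) = Set.domRestrict (Set.Iio i) (run h) := by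
    intro k h i hi
    funext j
    exact (hrun (cut h i hi) j.2).trans (hrun h (j.2.trans hi)).symm
  have hisrun : ∀ k, k ≤ lam.ord → ∀ h : G.History k, G.Follows σ h → S.IsRun (run h) k := by
    intro k
    induction k using WellFoundedLT.induction with
    | ind k ih =>
      intro hk h hh i hi
      have h1 := ih i hi (hi.le.trans hk) (cut h i hi) fun j => hh ⟨j.1, j.2.1, j.2.2.trans hi⟩
      have h2 := hgood (cut h i hi) (hi.trans_le hk) h1
      rw [hcut h hi] at h2
      rw [hrun h hi]
      refine ⟨h2, fun η hη => ?_⟩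
      have hs : S.start ≤ i := (h2.branch η hη).2.1
      have hlen := h2.len_eq η hη
      simp only [record, dif_pos hs]
      exact le_replyFun S.base (h ⟨i, hs, hi⟩) (hh ⟨i, hs, hi⟩).1 (hh ⟨i, hs, hi⟩).2
        ⟨hlen ▸ hs.trans (by simp), η, hη, le_rfl, fun _ => rfl⟩ hlen
  refine ⟨σ, fun k hs hk h hh => ?_, fun h hh => ?_⟩
  · have hr := hisrun k hk.le h hh
    have hg := hgood h hk hr
    have hr' := hr.snoc hg
    set y := Function.update (run h) k (mem k h, (mem k h).complete) with hy
    have hyk : (y k).1 = mem k h := by rw [hy, Function.update_self]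
    have hyj : ∀ j (hj : j < k), y j = record h j hj (mem j (cut h j hj)) := fun j hj => by
      rw [hy, Function.update_of_ne hj.ne, hrun h hj]
    have hkk : k < k + 1 := by simp
    have htree : ∀ j : Set.Ico S.start k, (h j).1.tree = S.tree (y j.1).1 := fun j => by
      rw [hyj j.1 j.2.2, (hh j).1]
      rfl
    refine ⟨?_, ⟨S.root, ?_, rfl⟩, fun j => ?_, fun j ν η hνη => ?_, ?_⟩
    · have := hr'.isCompleteTree hkk hs
      rwa [hyk] at this
    · have := hr'.isRoot hkk hs
      rwa [hyk] at this
    · have := hr'.tree_eq hkk j.2.1 j.2.2.le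
      rw [hyk] at this
      rw [htree j]
      exact this
    · have hη : η.1 ∈ (y k).1.top := hr'.mem_top_of_mem_tree hkk hs le_rfl
        (by rw [hyk]; exact η.2.1) η.2.2
      have hg' := (hr' k hkk).1
      have hle' := hg'.incomplete_le _ hη
      refine ⟨?_, ?_⟩
      · have h1 := (hg'.prev_le _ hη ⟨j.1, j.2.2⟩ j.2.1).trans hle'
        have h2 : η.1.take S.z (j.1 + 1) = ν.1 := by
          have := ((LSeq.isInitial_iff S.z).1 hνη.1).2
          rwa [ν.2.2] at this
        change (y j.1).2 (η.1.take S.z (j.1 + 1)) ≤ (y k).1.complete η.1 at h1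
        have h3 : (y j.1).2 = replyFun S.base (h j) := by
          rw [hyj j.1 j.2.2]
          exact dif_pos j.2.1
        rw [h2, hyk, h3] at h1
        exact (replyFun_of_mem S.base (h j) ν).symm.le.trans h1
      · have h1 := (hg'.base_le _ hη).trans hle'
        rw [hyk] at h1
        exact h1
    · refine lt_of_le_of_lt ?_ hg.card_lt
      have hsub : ∀ η : TopLevel (σ k h).tree k, η.1 ∈ (mem k h).top := fun η => by
        have := hr'.mem_top_of_mem_tree hkk hs le_rfl (η := η.1) (by rw [hyk]; exact η.2.1) η.2.2
        rwa [hyk] at this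
      exact Cardinal.mk_le_of_injective (f := fun η => (⟨η.1, hsub η⟩ : (mem k h).top))
        fun η η' he => Subtype.ext (congrArg (fun θ : (mem k h).top => θ.1) he)
  · have hr := hisrun lam.ord le_rfl h hh
    obtain ⟨q, hq, hfun, hall⟩ := hr.exists_name hstart hstrat
    refine ⟨q, hq, branchName (run h), hfun, fun i r hr' => ?_⟩
    obtain ⟨s, hrs, η, hη, hmemη, hgen⟩ := hall i.1 i.2.2 i.2.1 r hr'
    have hrec := hrun h i.2.2
    have htree : (h i).1.tree = S.tree (run h i.1).1 := by
      rw [hrec, (hh i).1]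
      rfl
    have hη' : η ∈ (h i).1.tree ∧ η.len = i.1 + 1 := by
      rw [htree]
      exact ⟨hr.mem_tree_of_mem_top i.2.2 le_rfl hη, (hr i.1 i.2.2).1.len_eq η hη⟩
    have h3 : (run h i.1).2 = replyFun S.base (h i) := by
      rw [hrec]
      exact dif_pos i.2.1
    refine ⟨s, hrs, ⟨η, hη'⟩, fun j hj => hmemη j hj, ?_⟩
    exact (congrArg (fun a => Forcing.inGeneric a s)
      ((congrFun h3 η).trans (replyFun_of_mem S.base (h i) ⟨η, hη'⟩))).mp hgen

end SacksSimulation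

theorem proposition3p2 (lam : Cardinal.{u}) (hlam : lam.IsInaccessible)
    (μ : Ordinal.{u} → Cardinal.{u})
    (hreg : ∀ α < lam.ord, (μ α).IsRegular)
    (hle : ∀ α < lam.ord, μ α ≤ lam)
    (hprod : ∀ α < lam.ord, ∀ f : α.ToType → Ordinal.{u}, (∀ ξ, f ξ < (μ α).ord) →
      Cardinal.prod (fun ξ => (f ξ).card) < μ α)
    (hmono : ∀ j < lam.ord, ∀ i < j, μ i ≤ μ j)
    (Q : Type v) [Preorder Q] (hQ : Atomless Q) :
    ReasonablyABounding lam μ Q ↔ StrongSacksProperty lam μ Q := by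
  have h0 : 0 < lam.ord := by
    rw [← Cardinal.ord_zero, Cardinal.ord_lt_ord]
    exact hlam.pos
  constructor
  · rintro ⟨hc, hA⟩
    refine ⟨hc, fun i₀ hi₀ p => ?_⟩
    obtain ⟨σ, hσ⟩ := hA p
    obtain ⟨c, hcp⟩ := hc p
    exact SacksSimulation.genericHasWinningStrategy ⟨⟨0, h0⟩, i₀, p, σ, c⟩ hlam.aleph0_lt.le hi₀
      hc hQ hcp hσ hreg hle hprod hmono
  · rintro ⟨hc, hS⟩
    exact ⟨hc, fun p => (hS 0 h0 p).rcAGame_of_sacksGame⟩
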